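/- **Definitions.** For a real $n\times p$ matrix $X$ and $s\ge 0$ let $\Sigma_s\subset\mathbb R^p$ be the set of vectors with at most $s$ nonzero coordinates, let $\mathfrak c_{\min}(s,X)$ be the least $c\ge0$ with $(1-c)\|x\|_2^2\le\|Xx\|_2^2$ for all $x\in\Sigma_s$, and let $\mathfrak c_{\max}(s,X)$ be the least $c\ge 0$ with $\|Xx\|_2^2\le(1+c)\|x\|_2^2$ for all $x\in\Sigma_s$. Condition SRSR-$\gamma(2s)$ for $X$ means: $\mathfrak c_{\min}(2s,X)<1$ and $$\frac{1+\mathfrak c_{\max}(2s,X)}{1-\mathfrak c_{\min}(2s,X)}<\frac{(4+\sqrt{41})^2}{25}.$$ For $s\ge1$, $X$ has stable and robust sparse recovery (SRSR) of order $s$ with constants $C,D$ if for all $x_0\in\mathbb R^p$, all $\eta\ge 0$, all $\mathbf e\in\mathbb R^n$ with $\|\mathbf e\|_2\le\eta$, and every minimizer $\hat x$ of $\|z\|_1$ subject to $\|Xx_0+\mathbf e-Xz\|_2\le\eta$, $$\|x_0-\hat x\|_1\le C\sigma_s(x_0)_1+D\sqrt s\,\eta,\qquad \|x_0-\hat x\|_2\le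 \tfrac{C}{\sqrt s}\sigma_s(x_0)_1+D\eta,$$ where $\sigma_s(x_0)_1=\min_{z\in\Sigma_s}\|x_0-z\|_1$. Let $\mathsf H(t)=-t\log t-(1-t)\log(1-t)$ for $0<t<1$. **Theorem.** For a sequence of integers $(p_n)$ let $X^{(n)}$ be a random $n\times p_n$ matrix of the form $X^{(n)}=\frac1{\sqrt n}G$, where $G$ has i.i.d. standard Gaussian entries. (i) There are positive functions $C,D$ on $\mathbb R^2$ such that the following holds. Let $0<\delta<1$ and $0<\rho<\frac{33-5\sqrt{41}}{16}$ with $$\delta>\frac1{2\rho}\exp\Bigg[1-\frac1{4\rho}\bigg(\sqrt{\tfrac{33-5\sqrt{41}}8}-\sqrt{2\rho}\bigg)^2\Bigg].$$ Then there are $D_1>0$ and $K$, depending only on $\delta$ and $\rho$, such that whenever $n/p_n\to\delta$, for all sufficiently large $n$, with probability at least $1-4e^{-nD_1}$: for every integer $s$ with $0\le s\le\lfloor\rho n\rfloor$, $X^{(n)}$ satisfies SRSR-$\gamma(2s)$ and, if $s\ge1$, has SRSR of order $s$ with the constants $C(\mathfrak c_{\min}(2s,X^{(n)}),\mathfrak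 c_{\max}(2s,X^{(n)}))\le K$ and $D(\mathfrak c_{\min}(2s,X^{(n)}),\mathfrak c_{\max}(2s,X^{(n)}))\le K$. (ii) Let $0<\bar\rho<1$, $0<\delta<1$, $\varepsilon>0$ and $t_0=\sqrt{2\mathsf H(\bar\rho\delta)/\delta}$. There is $D_2>0$, depending only on $\bar\rho,\delta,\varepsilon$, such that whenever $n/p_n\to\delta$, for all sufficiently large $n$, $$\mathbb P\Big\{\mathfrak c_{\max}(\lfloor\bar\rho n\rfloor,X^{(n)})\ge(\sqrt{\bar\rho}+t_0)(2+\sqrt{\bar\rho}+t_0)+\varepsilon\Big\}\le 2e^{-nD_2},$$ and, if $\sqrt{\bar\rho}+t_0\le 1$, $$\mathbb P\Big\{\mathfrak c_{\min}(\lfloor\bar\rho n\rfloor,X^{(n)})\ge(\sqrt{\bar\rho}+t_0)(2-\sqrt{\bar\rho}-t_0)+\varepsilon\Big\}\le 2e^{-nD_2}.$$ -/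

import Mathlib

open MeasureTheory ProbabilityTheory Filter Topology

universe u

namespace SparseRecovery

noncomputable section

/-- The Euclidean norm of a real vector. -/
def l2 {m : ℕ} (v : Fin m → ℝ) : ℝ := ‖(WithLp.toLp 2 v : PiLp 2 fun _ : Fin m => ℝ)‖

/-- The `ℓ₁`-norm of a real vector. -/
def l1 {m : ℕ} (v : Fin m → ℝ) : ℝ := ‖(WithLp.toLp 1 v : PiLp 1 fun _ : Fin m => ℝ)‖

/-- The set `Σ_s` of vectors with at most `s` nonzero coordinates. -/
def sparse (p s : ℕ) : Set (Fin p → ℝ) := {x | {i | x i ≠ 0}.ncard ≤ s}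

/-- The lower restricted isometry constant of order `s`: the least `c ≥ 0` such that
`(1 - c) ‖x‖₂² ≤ ‖M x‖₂²` on all `s`-sparse vectors. -/
def cMin {n p : ℕ} (s : ℕ) (M : Matrix (Fin n) (Fin p) ℝ) : ℝ :=
  sInf {c | 0 ≤ c ∧ ∀ x ∈ sparse p s, (1 - c) * l2 x ^ 2 ≤ l2 (M.mulVec x) ^ 2}

/-- The upper restricted isometry constant of order `s`: the least `c ≥ 0` such that
`‖M x‖₂² ≤ (1 + c) ‖x‖₂²` on all `s`-sparse vectors. -/
def cMax {n p : ℕ} (s : ℕ) (M : Matrix (Fin n) (Fin p) ℝ) : ℝ :=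
  sInf {c | 0 ≤ c ∧ ∀ x ∈ sparse p s, l2 (M.mulVec x) ^ 2 ≤ (1 + c) * l2 x ^ 2}

/-- The condition `γ(2s) = (1 + c_max(2s)) / (1 - c_min(2s)) < (4 + √41)² / 25`. The denominator
is required to be positive, so that the quotient is not a quotient by zero. -/
def GammaCondition {n p : ℕ} (s : ℕ) (M : Matrix (Fin n) (Fin p) ℝ) : Prop :=
  cMin (2 * s) M < 1 ∧ (1 + cMax (2 * s) M) / (1 - cMin (2 * s) M) < (4 + √41) ^ 2 / 25

/-- The error `σ_s(x)₁` of best `s`-term approximation in `ℓ₁`-norm. -/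
def bestApprox {p : ℕ} (s : ℕ) (x : Fin p → ℝ) : ℝ :=
  sInf ((fun z => l1 (x - z)) '' sparse p s)

/-- `x` minimizes the `ℓ₁`-norm among all `z` with `‖y - M z‖₂ ≤ η`. -/
def IsL1Solution {n p : ℕ} (M : Matrix (Fin n) (Fin p) ℝ) (y : Fin n → ℝ) (η : ℝ)
    (x : Fin p → ℝ) : Prop :=
  l2 (y - M.mulVec x) ≤ η ∧ ∀ z : Fin p → ℝ, l2 (y - M.mulVec z) ≤ η → l1 x ≤ l1 z

/-- Stable and robust sparse recovery of order `s` with constants `C` and `D`: for every target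
`x₀`, every error `e` with `‖e‖₂ ≤ η`, and every solution `x` of the `ℓ₁`-minimization
with data `y = M x₀ + e`, both error bounds hold. -/
def SRSR {n p : ℕ} (M : Matrix (Fin n) (Fin p) ℝ) (s : ℕ) (C D : ℝ) : Prop :=
  ∀ (x₀ : Fin p → ℝ) (e : Fin n → ℝ) (η : ℝ), l2 e ≤ η →
    ∀ x : Fin p → ℝ, IsL1Solution M (M.mulVec x₀ + e) η x →
      l1 (x₀ - x) ≤ C * bestApprox s x₀ + D * √s * η ∧
      l2 (x₀ - x) ≤ C / √s * bestApprox s x₀ + D * η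

/-- `G` is a random matrix with i.i.d. standard Gaussian entries. -/
def IsStdGaussianMatrix {Ω : Type u} [MeasurableSpace Ω] {n p : ℕ} (P : Measure Ω)
    (G : Ω → Matrix (Fin n) (Fin p) ℝ) : Prop :=
  (∀ i j, HasLaw (fun ω => G ω i j) (gaussianReal 0 1) P) ∧
    iIndepFun (fun (ij : Fin n × Fin p) ω => G ω ij.1 ij.2) P

/-- The design matrix `n^(-1/2) G`. -/
def scaled {n p : ℕ} (G : Matrix (Fin n) (Fin p) ℝ) : Matrix (Fin n) (Fin p) ℝ :=
  (1 / √(n : ℝ)) • G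

/-- `t₀ = √(2 H(r δ) / δ)` with `H` the Shannon entropy (natural logarithm). -/
def tZero (r δ : ℝ) : ℝ := √(2 * Real.binEntropy (r * δ) / δ)

end

end SparseRecovery

open SparseRecovery

/-!
The theorem combines a deterministic recovery theorem with sharp large deviations for the sparse
singular values of a Gaussian matrix.

**Recovery.** Let `m ‖x‖² ≤ ‖M x‖² ≤ L ‖x‖²` on `2s`-sparse vectors, and put
`κ = (L - m) / (2 √(L m))`. A discriminant argument shows that vectors `u`, `w` with disjoint
supports satisfy `|⟨M u, M w⟩| ‖u‖ ≤ κ ‖M u‖² ‖w‖` (`sq_dotProduct_mulVec_le`). Cutting the tail of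
a vector into blocks of decreasing magnitude and using the square root lifting inequality
(`abs_apply_restr_le`) turns this into the `ℓ₂`-robust null space property
(`normOn_le_of_restricted_isometry`), whose constant is below `1` exactly when `κ < 4 / 5`, and this
is the condition on `γ = L / m`. Stable and robust recovery follows (`srsr_of_restricted_isometry`).

**Large deviations.** The tails must have the exact exponential rate `t² / 2`, because they compete
with the entropy of the choice of the support. They come from Gordon's comparison of the process
`⟨u, G v⟩ + z` with `⟨u, g⟩ + ⟨v, h⟩`, applied to exponential moments of the min-max: the variable
`z` contributes a factor `exp (l² / 2)` on the left, which compensates for the two independent norms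
on the right, so that no separate concentration inequality is needed. Here `v` ranges over sparse unit
vectors of the full space, and the union over the supports is taken only for the norms of
restrictions of `h` (`measureReal_exists_lt_le`). The comparison itself is proved by interpolating
between the two processes and integrating by parts
(`integral_le_integral_of_covariance`), for the smooth functional
`(∑ v, (∑ u, exp (β x (u, v)))⁻¹) ^ θ` with `β θ` fixed and `θ → 0`
(`integral_exp_neg_le_of_covariance`). Finite index sets suffice since the bounds do not depend on
their size, and the event for all sparse vectors is an increasing union over finite sets.

**Conclusion.** The binomial coefficient grows with rate `t₀² / 2` (`eventually_choose_le`), so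
deviations beyond `√r + t₀` are exponentially unlikely (`eventually_measureReal_le`). For the first
part, `r = 2ρ`; the explicit condition on `(ρ, δ)` gives
`√r + t₀ < (√41 - 1) / (√41 + 9)` (`sqrt_add_tZero_lt`), which keeps `γ` below its threshold.
-/


namespace SparseRecovery

/-! ### Gaussian integration by parts -/

/-- The law of a family of independent standard Gaussian variables indexed by `κ`. -/
noncomputable abbrev stdGaussian (κ : Type*) [Fintype κ] : Measure (κ → ℝ) :=
  Measure.pi fun _ : κ => gaussianReal 0 1

theorem integrable_gaussianReal_iff (f : ℝ → ℝ) :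
    Integrable f (gaussianReal 0 1) ↔ Integrable (fun x => gaussianPDFReal 0 1 x * f x) := by
  rw [gaussianReal_of_var_ne_zero 0 one_ne_zero,
    integrable_withDensity_iff_integrable_smul' (measurable_gaussianPDF 0 1)
      (ae_of_all _ fun x => gaussianPDF_lt_top)]
  simp [toReal_gaussianPDF, smul_eq_mul]

theorem hasDerivAt_gaussianPDFReal (x : ℝ) :
    HasDerivAt (gaussianPDFReal 0 1) (-x * gaussianPDFReal 0 1 x) x := by
  have h : HasDerivAt (fun y : ℝ => -(y - 0) ^ 2 / (2 * ((1 : NNReal) : ℝ))) (-x) x := by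
    refine ((((hasDerivAt_id x).sub_const 0).pow 2).neg.div_const
      (2 * ((1 : NNReal) : ℝ))).congr_deriv ?_
    simp only [id, sub_zero, NNReal.coe_one]
    norm_num
    ring
  have := h.exp.const_mul (√(2 * Real.pi * ((1 : NNReal) : ℝ)))⁻¹
  refine this.congr_deriv ?_
  rw [gaussianPDFReal]
  ring

/-- Gaussian integration by parts in one variable. -/
theorem integral_id_mul_gaussianReal {f f' : ℝ → ℝ} (hf : ∀ x, HasDerivAt f (f' x) x)
    (h0 : Integrable f (gaussianReal 0 1)) (h1 : Integrable (fun x => x * f x) (gaussianReal 0 1))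
    (h2 : Integrable f' (gaussianReal 0 1)) :
    ∫ x, x * f x ∂gaussianReal 0 1 = ∫ x, f' x ∂gaussianReal 0 1 := by
  rw [integrable_gaussianReal_iff] at h0 h1 h2
  rw [integral_gaussianReal_eq_integral_smul one_ne_zero,
    integral_gaussianReal_eq_integral_smul one_ne_zero]
  have := integral_mul_deriv_eq_deriv_mul_of_integrable (A := ℝ) (u := gaussianPDFReal 0 1)
    (u' := fun x => -x * gaussianPDFReal 0 1 x) (v := f) (v' := f')
    (fun x _ => hasDerivAt_gaussianPDFReal x) (fun x _ => hf x)
    h2 (h1.neg.congr (ae_of_all _ fun x => by simp; ring)) h0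
  simp only [smul_eq_mul]
  rw [this, ← integral_neg]
  congr 1; ext x; ring

/-- Resampling one coordinate preserves a product law. -/
theorem measurePreserving_update {κ : Type*} [Fintype κ] [DecidableEq κ] (k : κ) :
    MeasurePreserving (fun q : (κ → ℝ) × ℝ => Function.update q.1 k q.2)
      ((stdGaussian κ).prod (gaussianReal 0 1)) (stdGaussian κ) := by
  have hm : Measurable (fun q : (κ → ℝ) × ℝ => Function.update q.1 k q.2) := by
    refine measurable_pi_lambda _ fun j => ?_
    by_cases h : j = k
    · subst h; simpa using measurable_snd
    · simpa [Function.update_of_ne h, Function.comp_def] using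
        (measurable_pi_apply j).comp (measurable_fst (α := κ → ℝ) (β := ℝ))
  refine ⟨hm, ?_⟩
  refine (Measure.pi_eq fun s hs => ?_).symm
  rw [Measure.map_apply hm (MeasurableSet.univ_pi hs)]
  have : (fun q : (κ → ℝ) × ℝ => Function.update q.1 k q.2) ⁻¹' (Set.univ.pi s)
      = (Set.univ.pi (Function.update s k Set.univ)) ×ˢ (s k) := by
    ext q
    simp only [Set.mem_preimage, Set.mem_pi, Set.mem_univ, true_imp_iff, Set.mem_prod]
    constructor
    · intro h
      refine ⟨fun j => ?_, by simpa using h k⟩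
      by_cases hj : j = k
      · subst hj; simp
      · simpa [Function.update_of_ne hj] using h j
    · rintro ⟨h, hk⟩ j
      by_cases hj : j = k
      · subst hj; simpa using hk
      · simpa [Function.update_of_ne hj] using h j
  rw [this, Measure.prod_prod, Measure.pi_pi, ← Finset.mul_prod_erase _ _ (Finset.mem_univ k),
    ← Finset.mul_prod_erase Finset.univ (fun i => gaussianReal 0 1 (s i)) (Finset.mem_univ k)]
  simp only [Function.update_self, measure_univ, one_mul]
  rw [mul_comm]
  congr 1
  refine Finset.prod_congr rfl fun j hj => ?_
  rw [Function.update_of_ne (Finset.ne_of_mem_erase hj)]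

/-- Gaussian integration by parts in one coordinate of a standard Gaussian vector. -/
theorem integral_coord_mul_stdGaussian {κ : Type*} [Fintype κ] [DecidableEq κ] (k : κ)
    {f f' : (κ → ℝ) → ℝ}
    (hf : ∀ w, HasDerivAt (fun x => f (Function.update w k x)) (f' w) (w k))
    (h0 : Integrable f (stdGaussian κ)) (h1 : Integrable (fun w => w k * f w) (stdGaussian κ))
    (h2 : Integrable f' (stdGaussian κ)) :
    ∫ w, w k * f w ∂stdGaussian κ = ∫ w, f' w ∂stdGaussian κ := by
  have key := measurePreserving_update (κ := κ) k
  have i0 := key.integrable_comp_of_integrable h0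
  have i1 := key.integrable_comp_of_integrable h1
  have i2 := key.integrable_comp_of_integrable h2
  have e : ∀ g : (κ → ℝ) → ℝ, Integrable g (stdGaussian κ) → ∫ w, g w ∂stdGaussian κ
      = ∫ q : (κ → ℝ) × ℝ, (g ∘ fun q => Function.update q.1 k q.2) q
        ∂(stdGaussian κ).prod (gaussianReal 0 1) := by
    intro g hg
    have := integral_map (μ := (stdGaussian κ).prod (gaussianReal 0 1)) (f := g)
      key.measurable.aemeasurable (by rw [key.map_eq]; exact hg.aestronglyMeasurable)
    rw [key.map_eq] at this
    exact this
  rw [e _ h1, e _ h2, integral_prod _ i1, integral_prod _ i2]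
  refine integral_congr_ae ?_
  filter_upwards [i0.prod_right_ae, i1.prod_right_ae, i2.prod_right_ae] with w a0 a1 a2
  simp only [Function.comp_def, Function.update_self] at a0 a1 a2 ⊢
  refine integral_id_mul_gaussianReal (fun x => ?_) a0 a1 a2
  simpa using hf (Function.update w k x)

/-- Exponential moments of the `ℓ₁`-norm of a standard Gaussian vector are finite. -/
theorem integrable_exp_sum_abs {κ : Type*} [Fintype κ] (c : ℝ) :
    Integrable (fun w : κ → ℝ => Real.exp (c * ∑ k, |w k|)) (stdGaussian κ) := by
  have h1 : Integrable (fun x : ℝ => Real.exp (c * |x|)) (gaussianReal 0 1) := by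
    have := integrable_exp_mul_gaussianReal (μ := 0) (v := 1) c
    have h' := integrable_exp_mul_gaussianReal (μ := 0) (v := 1) (-c)
    refine (this.add h').mono' (by fun_prop) (ae_of_all _ fun x => ?_)
    rw [Real.norm_eq_abs, abs_of_pos (Real.exp_pos _), Pi.add_apply]
    rcases abs_cases x with ⟨h, _⟩ | ⟨h, _⟩ <;> rw [h]
    · linarith [Real.exp_pos (-c * x)]
    · rw [mul_neg, ← neg_mul]; linarith [Real.exp_pos (c * x)]
  have := Integrable.fintype_prod (ι := κ) (f := fun _ x => Real.exp (c * |x|))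
    (μ := fun _ : κ => gaussianReal 0 1) (fun _ => h1)
  refine this.congr (ae_of_all _ fun w => ?_)
  simp [← Real.exp_sum, Finset.mul_sum]

/-! ### Gaussian interpolation -/

/-- `F` is differentiable along every differentiable curve, with partial derivatives `F'`. -/
def HasPartials {ι : Type*} [Fintype ι] (F : (ι → ℝ) → ℝ) (F' : (ι → ℝ) → ι → ℝ) : Prop :=
  ∀ (c : ℝ → ι → ℝ) (c' : ι → ℝ) (t : ℝ), (∀ i, HasDerivAt (fun s => c s i) (c' i) t) →
    HasDerivAt (fun s => F (c s)) (∑ i, F' (c t) i * c' i) t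

/-- `F` grows at most exponentially with respect to the `ℓ₁`-norm. -/
def ExpBounded {ι : Type*} [Fintype ι] (K c : ℝ) (F : (ι → ℝ) → ℝ) : Prop :=
  Continuous F ∧ ∀ x, |F x| ≤ K * Real.exp (c * ∑ i, |x i|)

/-- The Gaussian vector with coordinates `cos t ⟨x i, w⟩ + sin t ⟨y i, w⟩`. -/
noncomputable def interp {ι κ : Type*} [Fintype κ] (x y : ι → κ → ℝ) (t : ℝ) (w : κ → ℝ) (i : ι) :
    ℝ :=
  ∑ k, (Real.cos t * x i k + Real.sin t * y i k) * w k

theorem sum_abs_interp_le {ι κ : Type*} [Fintype ι] [Fintype κ] (x y : ι → κ → ℝ) (t : ℝ)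
    (w : κ → ℝ) :
    ∑ i, |interp x y t w i| ≤ (∑ i, ∑ k, (|x i k| + |y i k|)) * ∑ k, |w k| := by
  rw [Finset.sum_mul]
  refine Finset.sum_le_sum fun i _ => ?_
  rw [Finset.sum_mul]
  refine (Finset.abs_sum_le_sum_abs _ _).trans (Finset.sum_le_sum fun k _ => ?_)
  rw [abs_mul]
  refine mul_le_mul ?_ (Finset.single_le_sum (f := fun k => |w k|) (fun _ _ => abs_nonneg _)
    (Finset.mem_univ k)) (abs_nonneg _) (by positivity)
  refine (abs_add_le _ _).trans ?_
  rw [abs_mul, abs_mul]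
  have h1 := mul_le_of_le_one_left (abs_nonneg (x i k)) (Real.abs_cos_le_one t)
  have h2 := mul_le_of_le_one_left (abs_nonneg (y i k)) (Real.abs_sin_le_one t)
  linarith

theorem continuous_interp {ι κ : Type*} [Fintype κ] (x y : ι → κ → ℝ) (t : ℝ) :
    Continuous (interp x y t) := by
  unfold interp; fun_prop

/-- A single integrable function dominates `F` along the whole interpolation, with room for one
more factor that is linear in `w`. -/
theorem ExpBounded.comp_interp_le {ι κ : Type*} [Fintype ι] [Fintype κ] {K c : ℝ} (hK : 0 ≤ K)
    (hc : 0 ≤ c) {F : (ι → ℝ) → ℝ} (hF : ExpBounded K c F) (x y : ι → κ → ℝ) (t : ℝ) (w : κ → ℝ) :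
    |F (interp x y t w)| ≤
      K * Real.exp (c * (∑ i, ∑ k, (|x i k| + |y i k|)) * ∑ k, |w k|) := by
  refine (hF.2 _).trans (mul_le_mul_of_nonneg_left (Real.exp_le_exp.2 ?_) hK)
  rw [mul_assoc]
  exact mul_le_mul_of_nonneg_left (sum_abs_interp_le x y t w) hc

theorem ExpBounded.integrable_interp {ι κ : Type*} [Fintype ι] [Fintype κ] {K c : ℝ} (hK : 0 ≤ K)
    (hc : 0 ≤ c) {F : (ι → ℝ) → ℝ} (hF : ExpBounded K c F) (x y : ι → κ → ℝ) (t : ℝ) :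
    Integrable (fun w => F (interp x y t w)) (stdGaussian κ) := by
  refine ((integrable_exp_sum_abs _).const_mul K).mono'
    (hF.1.comp (continuous_interp x y t)).aestronglyMeasurable
    (ae_of_all _ fun w => hF.comp_interp_le hK hc x y t w)

theorem mul_exp_le {K C S u v : ℝ} (hu : |u| ≤ S) (hv : |v| ≤ K * Real.exp (C * S)) :
    |u * v| ≤ K * Real.exp ((C + 1) * S) := by
  have hS : S ≤ Real.exp S := by linarith [Real.add_one_le_exp S]
  rw [abs_mul, add_mul, one_mul, add_comm, Real.exp_add]
  calc |u| * |v| ≤ Real.exp S * (K * Real.exp (C * S)) :=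
        mul_le_mul (hu.trans hS) hv (abs_nonneg _) (Real.exp_pos _).le
    _ = _ := by ring

theorem abs_coord_le {κ : Type*} [Fintype κ] (w : κ → ℝ) (k : κ) : |w k| ≤ ∑ k, |w k| :=
  Finset.single_le_sum (f := fun k => |w k|) (fun _ _ => abs_nonneg _) (Finset.mem_univ k)

theorem ExpBounded.integrable_coord_mul_interp {ι κ : Type*} [Fintype ι] [Fintype κ] {K c : ℝ}
    (hK : 0 ≤ K) (hc : 0 ≤ c) {F : (ι → ℝ) → ℝ} (hF : ExpBounded K c F) (x y : ι → κ → ℝ) (t : ℝ)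
    (k : κ) :
    Integrable (fun w => w k * F (interp x y t w)) (stdGaussian κ) := by
  refine ((integrable_exp_sum_abs (c * (∑ i, ∑ k, (|x i k| + |y i k|)) + 1)).const_mul K).mono'
    ((continuous_apply k).mul (hF.1.comp (continuous_interp x y t))).aestronglyMeasurable
    (ae_of_all _ fun w => ?_)
  exact mul_exp_le (abs_coord_le w k) (hF.comp_interp_le hK hc x y t w)

theorem hasDerivAt_interp {ι κ : Type*} [Fintype κ] (x y : ι → κ → ℝ) (w : κ → ℝ) (i : ι) (t : ℝ) :
    HasDerivAt (fun s => interp x y s w i)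
      (∑ k, (-Real.sin t * x i k + Real.cos t * y i k) * w k) t := by
  unfold interp
  refine HasDerivAt.fun_sum fun k _ => ?_
  exact (((Real.hasDerivAt_cos t).mul_const _).add
    ((Real.hasDerivAt_sin t).mul_const _)).mul_const _

/-- The derivative of `t ↦ E F(Z_t)` along the interpolation, before integration by parts. -/
theorem hasDerivAt_integral_interp {ι κ : Type*} [Fintype ι] [Fintype κ] {K c : ℝ} (hK : 0 ≤ K)
    (hc : 0 ≤ c) {F : (ι → ℝ) → ℝ} {F' : (ι → ℝ) → ι → ℝ} (hF : ExpBounded K c F)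
    (hF' : ∀ i, ExpBounded K c fun z => F' z i) (hd : HasPartials F F') (x y : ι → κ → ℝ) (t : ℝ) :
    HasDerivAt (fun s => ∫ w, F (interp x y s w) ∂stdGaussian κ)
      (∑ i, ∑ k, (-Real.sin t * x i k + Real.cos t * y i k) *
        ∫ w, w k * F' (interp x y t w) i ∂stdGaussian κ) t := by
  set A := c * ∑ i, ∑ k, (|x i k| + |y i k|) with hA
  have hint : ∀ i k, Integrable (fun w => (-Real.sin t * x i k + Real.cos t * y i k) *
      (w k * F' (interp x y t w) i)) (stdGaussian κ) := fun i k =>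
    ((hF' i).integrable_coord_mul_interp hK hc x y t k).const_mul _
  have hsum : ∀ s (w : κ → ℝ), ∑ i, F' (interp x y s w) i *
      (∑ k, (-Real.sin s * x i k + Real.cos s * y i k) * w k)
      = ∑ i, ∑ k, (-Real.sin s * x i k + Real.cos s * y i k) * (w k * F' (interp x y s w) i) := by
    intro s w
    refine Finset.sum_congr rfl fun i _ => ?_
    rw [Finset.mul_sum]
    exact Finset.sum_congr rfl fun k _ => by ring
  have key := (hasDerivAt_integral_of_dominated_loc_of_deriv_le (μ := stdGaussian κ) (𝕜 := ℝ)
    (F := fun s w => F (interp x y s w)) (x₀ := t) (s := Set.univ)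
    (F' := fun s w => ∑ i, F' (interp x y s w) i *
      (∑ k, (-Real.sin s * x i k + Real.cos s * y i k) * w k))
    (bound := fun w => ∑ i, ∑ k, (|x i k| + |y i k|) *
      (K * Real.exp ((A + 1) * ∑ k, |w k|)))
    univ_mem
    (Eventually.of_forall fun s => (hF.1.comp (continuous_interp x y s)).aestronglyMeasurable)
    (hF.integrable_interp hK hc x y t) ?_ ?_ ?_ ?_).2
  · refine key.congr_deriv ?_
    simp only [hsum]
    rw [integral_finsetSum _ fun i _ => integrable_finsetSum _ fun k _ => hint i k]
    refine Finset.sum_congr rfl fun i _ => ?_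
    rw [integral_finsetSum _ fun k _ => hint i k]
    exact Finset.sum_congr rfl fun k _ => integral_const_mul _ _
  · simp only [hsum]
    exact (integrable_finsetSum _ fun i _ =>
      integrable_finsetSum _ fun k _ => hint i k).aestronglyMeasurable
  · refine ae_of_all _ fun w s _ => ?_
    rw [hsum, Real.norm_eq_abs]
    refine (Finset.abs_sum_le_sum_abs _ _).trans (Finset.sum_le_sum fun i _ => ?_)
    refine (Finset.abs_sum_le_sum_abs _ _).trans (Finset.sum_le_sum fun k _ => ?_)
    rw [abs_mul]
    refine mul_le_mul ?_ ?_ (abs_nonneg _) (by positivity)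
    · refine (abs_add_le _ _).trans ?_
      rw [abs_mul, abs_mul, abs_neg]
      have h1 := mul_le_of_le_one_left (abs_nonneg (x i k)) (Real.abs_sin_le_one s)
      have h2 := mul_le_of_le_one_left (abs_nonneg (y i k)) (Real.abs_cos_le_one s)
      linarith
    · exact mul_exp_le (abs_coord_le w k) ((hF' i).comp_interp_le hK hc x y s w)
  · exact integrable_finsetSum _ fun i _ => integrable_finsetSum _ fun k _ =>
      ((integrable_exp_sum_abs _).const_mul K).const_mul _
  · exact ae_of_all _ fun w s _ => hd _ _ _ fun i => hasDerivAt_interp x y w i s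

/-- Integration by parts for a function of the interpolated vector. -/
theorem integral_coord_mul_interp {ι κ : Type*} [Fintype ι] [Fintype κ] {K c : ℝ} (hK : 0 ≤ K)
    (hc : 0 ≤ c) {F : (ι → ℝ) → ℝ} {F' : (ι → ℝ) → ι → ℝ} (hF : ExpBounded K c F)
    (hF' : ∀ i, ExpBounded K c fun z => F' z i) (hd : HasPartials F F') (x y : ι → κ → ℝ) (t : ℝ)
    (k : κ) :
    ∫ w, w k * F (interp x y t w) ∂stdGaussian κ =
      ∑ j, (Real.cos t * x j k + Real.sin t * y j k) *
        ∫ w, F' (interp x y t w) j ∂stdGaussian κ := by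
  classical
  have hint : ∀ j, Integrable (fun w => F' (interp x y t w) j *
      (Real.cos t * x j k + Real.sin t * y j k)) (stdGaussian κ) := fun j =>
    ((hF' j).integrable_interp hK hc x y t).mul_const _
  rw [integral_coord_mul_stdGaussian k (f := fun w => F (interp x y t w))
    (f' := fun w => ∑ j, F' (interp x y t w) j * (Real.cos t * x j k + Real.sin t * y j k))
    (fun w => ?_) (hF.integrable_interp hK hc x y t)
    (hF.integrable_coord_mul_interp hK hc x y t k) (integrable_finsetSum _ fun j _ => hint j)]
  · rw [integral_finsetSum _ fun j _ => hint j]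
    refine Finset.sum_congr rfl fun j _ => ?_
    rw [integral_mul_const, mul_comm]
  · have := hd (fun s => interp x y t (Function.update w k s))
      (fun j => Real.cos t * x j k + Real.sin t * y j k) (w k) (fun j => ?_)
    · simpa using this
    · unfold interp
      have : ∀ l ∈ Finset.univ, HasDerivAt (fun s => (Real.cos t * x j l + Real.sin t * y j l) *
          Function.update w k s l) ((Real.cos t * x j l + Real.sin t * y j l) *
          (if l = k then 1 else 0)) (w k) := by
        intro l _
        refine HasDerivAt.const_mul _ ?_
        by_cases h : l = k
        · subst h; simpa using hasDerivAt_id' (w l)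
        · simpa [Function.update_of_ne h, h] using hasDerivAt_const (w k) (w l)
      simpa using HasDerivAt.fun_sum this

/-- **Gaussian comparison.** Let `X i = ⟨x i, w⟩` and `Y i = ⟨y i, w⟩` be two independent centred
Gaussian vectors. If the difference of the covariances pairs nonpositively with the second
derivatives of `F`, then `E F(X) ≤ E F(Y)`. -/
theorem integral_le_integral_of_covariance {ι κ : Type*} [Fintype ι] [Fintype κ] {K c : ℝ}
    (hK : 0 ≤ K) (hc : 0 ≤ c) {F : (ι → ℝ) → ℝ} {F' : (ι → ℝ) → ι → ℝ}
    {F'' : (ι → ℝ) → ι → ι → ℝ} (hF : ExpBounded K c F) (hF' : ∀ i, ExpBounded K c fun z => F' z i)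
    (hF'' : ∀ i j, ExpBounded K c fun z => F'' z i j) (hd : HasPartials F F')
    (hd' : ∀ i, HasPartials (fun z => F' z i) fun z => F'' z i) (x y : ι → κ → ℝ)
    (hxy : ∀ i j, ∑ k, x i k * y j k = 0)
    (hcov : ∀ z, ∑ i, ∑ j, (∑ k, x i k * x j k - ∑ k, y i k * y j k) * F'' z i j ≤ 0) :
    ∫ w, F (fun i => ∑ k, x i k * w k) ∂stdGaussian κ ≤
      ∫ w, F (fun i => ∑ k, y i k * w k) ∂stdGaussian κ := by
  have hder : ∀ t, HasDerivAt (fun s => ∫ w, F (interp x y s w) ∂stdGaussian κ)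
      (-(Real.sin t * Real.cos t) * ∫ w, ∑ i, ∑ j, (∑ k, x i k * x j k - ∑ k, y i k * y j k) *
        F'' (interp x y t w) i j ∂stdGaussian κ) t := by
    intro t
    refine (hasDerivAt_integral_interp hK hc hF hF' hd x y t).congr_deriv ?_
    have hint : ∀ i j, Integrable (fun w => (∑ k, x i k * x j k - ∑ k, y i k * y j k) *
        F'' (interp x y t w) i j) (stdGaussian κ) := fun i j =>
      ((hF'' i j).integrable_interp hK hc x y t).const_mul _
    rw [integral_finsetSum _ fun i _ => integrable_finsetSum _ fun j _ => hint i j,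
      Finset.mul_sum]
    refine Finset.sum_congr rfl fun i _ => ?_
    rw [integral_finsetSum _ fun j _ => hint i j, Finset.mul_sum]
    have : ∀ k, ∫ w, w k * F' (interp x y t w) i ∂stdGaussian κ = _ := fun k =>
      integral_coord_mul_interp hK hc (hF' i) (hF'' i) (hd' i) x y t k
    simp only [this, Finset.mul_sum]
    rw [Finset.sum_comm]
    refine Finset.sum_congr rfl fun j _ => ?_
    rw [integral_const_mul]
    simp only [← mul_assoc]
    rw [← Finset.sum_mul]
    congr 1
    have e : ∀ k, (-Real.sin t * x i k + Real.cos t * y i k) *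
        (Real.cos t * x j k + Real.sin t * y j k) =
        -(Real.sin t * Real.cos t) * (x i k * x j k) + Real.sin t * Real.cos t * (y i k * y j k)
        - Real.sin t ^ 2 * (x i k * y j k) + Real.cos t ^ 2 * (x j k * y i k) := fun k => by ring
    simp only [e, Finset.sum_add_distrib, Finset.sum_sub_distrib, ← Finset.mul_sum, hxy]
    ring
  have hmono : MonotoneOn (fun s => ∫ w, F (interp x y s w) ∂stdGaussian κ)
      (Set.Icc 0 (Real.pi / 2)) := by
    refine monotoneOn_of_deriv_nonneg (convex_Icc _ _)
      (fun t _ => (hder t).continuousAt.continuousWithinAt)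
      (fun t _ => (hder t).differentiableAt.differentiableWithinAt) fun t ht => ?_
    rw [interior_Icc] at ht
    rw [(hder t).deriv]
    refine mul_nonneg_of_nonpos_of_nonpos ?_ (integral_nonpos fun w => hcov _)
    have h1 := Real.sin_pos_of_pos_of_lt_pi ht.1 (by linarith [ht.2, Real.pi_pos])
    have h2 := Real.cos_pos_of_mem_Ioo ⟨by linarith [ht.1, Real.pi_pos], ht.2⟩
    nlinarith [mul_pos h1 h2]
  have hpi := Real.pi_pos
  have := hmono (Set.left_mem_Icc.2 (by positivity)) (Set.right_mem_Icc.2 (by positivity))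
    (by positivity)
  have e0 : interp x y 0 = fun w i => ∑ k, x i k * w k := by funext w i; simp [interp]
  have e1 : interp x y (Real.pi / 2) = fun w i => ∑ k, y i k * w k := by
    funext w i; simp [interp]
  simpa only [e0, e1] using this

/-! ### Gordon's comparison inequality -/

theorem HasPartials.mul {ι : Type*} [Fintype ι] {F G : (ι → ℝ) → ℝ} {F' G' : (ι → ℝ) → ι → ℝ}
    (hF : HasPartials F F') (hG : HasPartials G G') :
    HasPartials (fun z => F z * G z) fun z i => F' z i * G z + F z * G' z i := by
  intro c c' t hc
  refine ((hF c c' t hc).mul (hG c c' t hc)).congr_deriv ?_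
  rw [Finset.sum_mul, Finset.mul_sum, ← Finset.sum_add_distrib]
  exact Finset.sum_congr rfl fun i _ => by ring

theorem HasPartials.const_mul {ι : Type*} [Fintype ι] {F : (ι → ℝ) → ℝ} {F' : (ι → ℝ) → ι → ℝ}
    (hF : HasPartials F F') (a : ℝ) : HasPartials (fun z => a * F z) fun z i => a * F' z i := by
  intro c c' t hc
  refine ((hF c c' t hc).const_mul a).congr_deriv ?_
  rw [Finset.mul_sum]
  exact Finset.sum_congr rfl fun i _ => by ring

theorem HasPartials.inv {ι : Type*} [Fintype ι] {F : (ι → ℝ) → ℝ} {F' : (ι → ℝ) → ι → ℝ}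
    (hF : HasPartials F F') (h0 : ∀ z, F z ≠ 0) :
    HasPartials (fun z => (F z)⁻¹) fun z i => -((F z)⁻¹ * (F z)⁻¹ * F' z i) := by
  intro c c' t hc
  refine ((hF c c' t hc).fun_inv (h0 _)).congr_deriv ?_
  simp only [neg_mul, Finset.sum_neg_distrib, mul_assoc, ← Finset.mul_sum]
  have := h0 (c t)
  field_simp

theorem HasPartials.rpow {ι : Type*} [Fintype ι] {F : (ι → ℝ) → ℝ} {F' : (ι → ℝ) → ι → ℝ}
    (hF : HasPartials F F') (h0 : ∀ z, 0 < F z) (θ : ℝ) :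
    HasPartials (fun z => F z ^ θ) fun z i => θ * (F z ^ θ * (F z)⁻¹ * F' z i) := by
  intro c c' t hc
  refine ((hF c c' t hc).rpow_const (Or.inl (h0 _).ne')).congr_deriv ?_
  simp only [mul_assoc, ← Finset.mul_sum]
  rw [Real.rpow_sub_one (h0 _).ne', div_eq_mul_inv]
  ring

theorem HasPartials.sum {ι σ : Type*} [Fintype ι] [Fintype σ] {F : σ → (ι → ℝ) → ℝ}
    {F' : σ → (ι → ℝ) → ι → ℝ} (hF : ∀ a, HasPartials (F a) (F' a)) :
    HasPartials (fun z => ∑ a, F a z) fun z i => ∑ a, F' a z i := by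
  intro c c' t hc
  refine (HasDerivAt.fun_sum fun a _ => hF a c c' t hc).congr_deriv ?_
  rw [Finset.sum_comm]
  exact Finset.sum_congr rfl fun i _ => by rw [Finset.sum_mul]

theorem hasPartials_exp {ι : Type*} [Fintype ι] [DecidableEq ι] (β : ℝ) (j : ι) :
    HasPartials (fun z => Real.exp (β * z j)) fun z i => if j = i then β * Real.exp (β * z j) else 0
    := by
  intro c c' t hc
  refine ((hc j).const_mul β).exp.congr_deriv ?_
  simp only [ite_mul, zero_mul, Finset.sum_ite_eq, Finset.mem_univ, if_true]
  ring

/-- Continuous functions of at most exponential growth. -/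
def ExpGrowth {ι : Type*} [Fintype ι] (F : (ι → ℝ) → ℝ) : Prop :=
  ∃ K c, 0 ≤ K ∧ 0 ≤ c ∧ ExpBounded K c F

theorem ExpGrowth.mul {ι : Type*} [Fintype ι] {F G : (ι → ℝ) → ℝ} (hF : ExpGrowth F)
    (hG : ExpGrowth G) : ExpGrowth fun z => F z * G z := by
  obtain ⟨K, c, hK, hc, h⟩ := hF
  obtain ⟨K', c', hK', hc', h'⟩ := hG
  refine ⟨K * K', c + c', by positivity, by positivity, h.1.mul h'.1, fun x => ?_⟩
  rw [abs_mul, add_mul, Real.exp_add, mul_mul_mul_comm]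
  exact mul_le_mul (h.2 x) (h'.2 x) (abs_nonneg _) (by positivity)

theorem ExpBounded.mono {ι : Type*} [Fintype ι] {F : (ι → ℝ) → ℝ} {K c K' c' : ℝ}
    (h : ExpBounded K c F) (hK : 0 ≤ K) (hKK : K ≤ K') (hcc : c ≤ c') : ExpBounded K' c' F := by
  refine ⟨h.1, fun x => (h.2 x).trans ?_⟩
  have : 0 ≤ ∑ i, |x i| := Finset.sum_nonneg fun _ _ => abs_nonneg _
  have : 0 ≤ K' := hK.trans hKK
  gcongr

theorem ExpGrowth.add {ι : Type*} [Fintype ι] {F G : (ι → ℝ) → ℝ} (hF : ExpGrowth F)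
    (hG : ExpGrowth G) : ExpGrowth fun z => F z + G z := by
  obtain ⟨K, c, hK, hc, h⟩ := hF
  obtain ⟨K', c', hK', hc', h'⟩ := hG
  refine ⟨K + K', c + c', by positivity, by positivity, h.1.add h'.1, fun x => ?_⟩
  have h1 := (h.mono hK le_rfl (by linarith : c ≤ c + c')).2 x
  have h2 := (h'.mono hK' le_rfl (by linarith : c' ≤ c + c')).2 x
  rw [add_mul]
  exact (abs_add_le _ _).trans (add_le_add h1 h2)

theorem expGrowth_const {ι : Type*} [Fintype ι] (a : ℝ) : ExpGrowth fun _ : ι → ℝ => a :=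
  ⟨|a|, 0, abs_nonneg _, le_rfl, continuous_const, fun x => by simp⟩

theorem ExpGrowth.sum {ι σ : Type*} [Fintype ι] {F : σ → (ι → ℝ) → ℝ}
    (hF : ∀ a, ExpGrowth (F a)) (s : Finset σ) : ExpGrowth fun z => ∑ a ∈ s, F a z := by
  classical
  induction s using Finset.induction_on with
  | empty => simpa using expGrowth_const 0
  | insert a s ha ih => simpa [Finset.sum_insert ha] using (hF a).add ih

theorem ExpGrowth.of_le {ι : Type*} [Fintype ι] {F G : (ι → ℝ) → ℝ} (hG : ExpGrowth G)
    (hF : Continuous F) (hle : ∀ z, |F z| ≤ G z) : ExpGrowth F := by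
  obtain ⟨K, c, hK, hc, h⟩ := hG
  exact ⟨K, c, hK, hc, hF, fun x => (hle x).trans ((le_abs_self _).trans (h.2 x))⟩

theorem expGrowth_exp {ι : Type*} [Fintype ι] (β : ℝ) (i : ι) :
    ExpGrowth fun z : ι → ℝ => Real.exp (β * z i) := by
  refine ⟨1, |β|, zero_le_one, abs_nonneg _, by fun_prop, fun x => ?_⟩
  rw [abs_of_pos (Real.exp_pos _), one_mul, Real.exp_le_exp]
  refine (le_abs_self _).trans ?_
  rw [abs_mul]
  exact mul_le_mul_of_nonneg_left (abs_coord_le x i) (abs_nonneg _)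

theorem exists_expBounded_of_expGrowth {ι σ : Type*} [Fintype ι] [Fintype σ]
    {F : σ → (ι → ℝ) → ℝ} (hF : ∀ a, ExpGrowth (F a)) :
    ∃ K c, 0 ≤ K ∧ 0 ≤ c ∧ ∀ a, ExpBounded K c (F a) := by
  choose K c hK hc h using hF
  refine ⟨∑ a, K a, ∑ a, c a, Finset.sum_nonneg fun a _ => hK a, Finset.sum_nonneg fun a _ => hc a,
    fun a => (h a).mono (hK a) ?_ ?_⟩
  · exact Finset.single_le_sum (fun a _ => hK a) (Finset.mem_univ a)
  · exact Finset.single_le_sum (fun a _ => hc a) (Finset.mem_univ a)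

section SoftMinMax

variable {U V : Type*} [Fintype U]

/-- The exponential sum `∑ u, exp (β z (u, v))`, a smooth proxy for `exp (β max_u z (u, v))`. -/
noncomputable def expSum (β : ℝ) (v : V) (z : U × V → ℝ) : ℝ := ∑ u, Real.exp (β * z (u, v))

theorem expSum_pos [Nonempty U] (β : ℝ) (v : V) (z : U × V → ℝ) : 0 < expSum β v z :=
  Finset.sum_pos (fun _ _ => Real.exp_pos _) Finset.univ_nonempty

theorem continuous_inv_expSum [Nonempty U] (β : ℝ) (v : V) :
    Continuous fun z => (expSum (U := U) β v z)⁻¹ :=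
  (show Continuous (expSum (U := U) β v) by unfold expSum; fun_prop).inv₀
    fun z => (expSum_pos β v z).ne'

variable [Fintype V]

/-- A smooth proxy for `exp (-β min_v max_u z (u, v))`. -/
noncomputable def invExpSum (β : ℝ) (z : U × V → ℝ) : ℝ := ∑ v, (expSum β v z)⁻¹

theorem invExpSum_pos [Nonempty U] [Nonempty V] (β : ℝ) (z : U × V → ℝ) : 0 < invExpSum β z :=
  Finset.sum_pos (fun v _ => inv_pos.2 (expSum_pos β v z)) Finset.univ_nonempty

theorem expGrowth_expSum (β : ℝ) (v : V) : ExpGrowth (expSum (U := U) β v) :=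
  ExpGrowth.sum (fun u => expGrowth_exp β (u, v)) _

theorem expGrowth_inv_expSum [Nonempty U] (β : ℝ) (v : V) :
    ExpGrowth fun z => (expSum (U := U) β v z)⁻¹ := by
  obtain ⟨u₀⟩ := ‹Nonempty U›
  have : Nonempty U := ⟨u₀⟩
  refine (expGrowth_exp (-β) (u₀, v)).of_le (continuous_inv_expSum β v) fun z => ?_
  rw [abs_of_pos (inv_pos.2 (expSum_pos β v z)), neg_mul, Real.exp_neg]
  exact inv_anti₀ (Real.exp_pos _) (Finset.single_le_sum
    (f := fun u => Real.exp (β * z (u, v))) (fun _ _ => (Real.exp_pos _).le) (Finset.mem_univ u₀))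

theorem continuous_invExpSum [Nonempty U] (β : ℝ) : Continuous (invExpSum (U := U) (V := V) β) :=
  continuous_finsetSum _ fun v _ => continuous_inv_expSum β v

theorem expGrowth_inv_invExpSum [Nonempty U] [Nonempty V] (β : ℝ) :
    ExpGrowth fun z => (invExpSum (U := U) (V := V) β z)⁻¹ := by
  obtain ⟨v₀⟩ := ‹Nonempty V›
  have : Nonempty V := ⟨v₀⟩
  refine (expGrowth_expSum β v₀).of_le
    ((continuous_invExpSum β).inv₀ fun z => (invExpSum_pos β z).ne') fun z => ?_
  rw [abs_of_pos (inv_pos.2 (invExpSum_pos β z))]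
  refine inv_le_of_inv_le₀ (expSum_pos β v₀ z) ?_
  exact Finset.single_le_sum (f := fun v => (expSum β v z)⁻¹)
    (fun v _ => (inv_pos.2 (expSum_pos β v z)).le) (Finset.mem_univ v₀)

theorem expGrowth_rpow_invExpSum [Nonempty U] [Nonempty V] (β : ℝ) {θ : ℝ} (h0 : 0 ≤ θ)
    (h1 : θ ≤ 1) : ExpGrowth fun z => invExpSum (U := U) (V := V) β z ^ θ := by
  refine ((expGrowth_const 1).add (ExpGrowth.sum (fun v => expGrowth_inv_expSum (U := U) β v)
    (Finset.univ : Finset V))).of_le ((continuous_invExpSum β).rpow_const fun z => Or.inr h0)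
    fun z => ?_
  have hT := invExpSum_pos β z
  rw [abs_of_pos (Real.rpow_pos_of_pos hT _)]
  change _ ≤ 1 + invExpSum β z
  rcases le_total (invExpSum β z) 1 with h | h
  · linarith [Real.rpow_le_one hT.le h h0]
  · have := Real.rpow_le_rpow_of_exponent_le h h1
    rw [Real.rpow_one] at this
    linarith

variable [DecidableEq U] [DecidableEq V]

theorem hasPartials_expSum (β : ℝ) (v : V) :
    HasPartials (expSum (U := U) β v) fun z i => if v = i.2 then β * Real.exp (β * z i) else 0 := by
  have := HasPartials.sum fun u : U => hasPartials_exp β (u, v)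
  refine fun c c' t hc => (this c c' t hc).congr_deriv (Finset.sum_congr rfl fun i _ => ?_)
  congr 1
  obtain ⟨a, b⟩ := i
  by_cases h : v = b
  · subst h; simp
  · simp [h]

theorem hasPartials_inv_expSum [Nonempty U] (β : ℝ) (v : V) :
    HasPartials (fun z => (expSum (U := U) β v z)⁻¹) fun z i => -((expSum β v z)⁻¹ *
      (expSum β v z)⁻¹ * if v = i.2 then β * Real.exp (β * z i) else 0) :=
  (hasPartials_expSum β v).inv fun z => (expSum_pos β v z).ne'

theorem hasPartials_invExpSum [Nonempty U] (β : ℝ) :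
    HasPartials (invExpSum (U := U) (V := V) β) fun z i =>
      -(β * (Real.exp (β * z i) * ((expSum β i.2 z)⁻¹ * (expSum β i.2 z)⁻¹))) := by
  have := HasPartials.sum fun v : V => hasPartials_inv_expSum (U := U) β v
  refine fun c c' t hc => (this c c' t hc).congr_deriv (Finset.sum_congr rfl fun i _ => ?_)
  congr 1
  simp only [mul_ite, mul_zero, Finset.sum_neg_distrib, Finset.sum_ite_eq', Finset.mem_univ,
    if_true]
  ring

/-- The Gordon comparison inequality for the smooth proxies. -/
theorem integral_rpow_invExpSum_le {κ : Type*} [Fintype κ] [Nonempty U] [Nonempty V] {β θ : ℝ}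
    (h0 : 0 ≤ θ) (h1 : θ ≤ 1) (x y : U × V → κ → ℝ) (hxy : ∀ i j, ∑ k, x i k * y j k = 0)
    (hne : ∀ i j, i.2 ≠ j.2 → ∑ k, y i k * y j k ≤ ∑ k, x i k * x j k)
    (heq : ∀ i j, i.2 = j.2 → ∑ k, y i k * y j k = ∑ k, x i k * x j k) :
    ∫ w, invExpSum β (fun i => ∑ k, x i k * w k) ^ θ ∂stdGaussian κ ≤
      ∫ w, invExpSum β (fun i => ∑ k, y i k * w k) ^ θ ∂stdGaussian κ := by
  have hT := hasPartials_invExpSum (U := U) (V := V) β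
  have hTθ := hT.rpow (invExpSum_pos β) θ
  have hTi := hT.inv fun z => (invExpSum_pos β z).ne'
  have gθ := expGrowth_rpow_invExpSum (U := U) (V := V) β h0 h1
  have gi := expGrowth_inv_invExpSum (U := U) (V := V) β
  have gS := fun v : V => expGrowth_inv_expSum (U := U) β v
  have gE := fun i : U × V => expGrowth_exp β i
  -- the gradient of `T ^ θ`, in a form to which the product rule applies again
  have hd : HasPartials (fun z => invExpSum (U := U) (V := V) β z ^ θ) fun z i =>
      -(θ * β) * (invExpSum β z ^ θ * (invExpSum β z)⁻¹ *
        (Real.exp (β * z i) * ((expSum β i.2 z)⁻¹ * (expSum β i.2 z)⁻¹))) :=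
    fun c c' t hc => (hTθ c c' t hc).congr_deriv (Finset.sum_congr rfl fun i _ => by ring)
  have hd' := fun i : U × V => (((hTθ.mul hTi).mul ((hasPartials_exp β i).mul
    ((hasPartials_inv_expSum (U := U) β i.2).mul (hasPartials_inv_expSum β i.2)))).const_mul
      (-(θ * β)))
  have gF' : ∀ i : U × V, ExpGrowth fun z : U × V → ℝ =>
      -(θ * β) * (invExpSum β z ^ θ * (invExpSum β z)⁻¹ *
        (Real.exp (β * z i) * ((expSum β i.2 z)⁻¹ * (expSum β i.2 z)⁻¹))) := fun i =>
    (expGrowth_const _).mul ((gθ.mul gi).mul ((gE i).mul ((gS _).mul (gS _))))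
  have gneg : ∀ {F : (U × V → ℝ) → ℝ}, ExpGrowth F → ExpGrowth fun z => -F z := fun h => by
    simpa using (expGrowth_const (-1)).mul h
  have gite : ∀ {F : (U × V → ℝ) → ℝ} (P : Prop) [Decidable P], ExpGrowth F →
      ExpGrowth fun z => if P then F z else 0 := fun P _ h => by
    by_cases hP : P
    · simpa [hP] using h
    · simpa [hP] using expGrowth_const 0
  have gT : ∀ j : U × V, ExpGrowth fun z : U × V → ℝ =>
      -(β * (Real.exp (β * z j) * ((expSum β j.2 z)⁻¹ * (expSum β j.2 z)⁻¹))) := fun j =>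
    gneg ((expGrowth_const _).mul ((gE j).mul ((gS _).mul (gS _))))
  have gSi : ∀ i j : U × V, ExpGrowth fun z : U × V → ℝ => -((expSum β i.2 z)⁻¹ *
      (expSum β i.2 z)⁻¹ * if i.2 = j.2 then β * Real.exp (β * z j) else 0) := fun i j =>
    gneg (((gS _).mul (gS _)).mul (gite _ ((expGrowth_const _).mul (gE j))))
  have gF'' := fun i j : U × V => (expGrowth_const (ι := U × V) (-(θ * β))).mul
    ((((((expGrowth_const θ).mul ((gθ.mul gi).mul (gT j))).mul gi).add
      (gθ.mul (gneg ((gi.mul gi).mul (gT j))))).mul ((gE i).mul ((gS i.2).mul (gS i.2)))).add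
      ((gθ.mul gi).mul (((gite (i = j) ((expGrowth_const β).mul (gE i))).mul
        ((gS i.2).mul (gS i.2))).add ((gE i).mul (((gSi i j).mul (gS i.2)).add
          ((gS i.2).mul (gSi i j)))))))
  obtain ⟨K₀, c₀, hK₀, hc₀, b₀⟩ := gθ
  obtain ⟨K₁, c₁, hK₁, hc₁, b₁⟩ := exists_expBounded_of_expGrowth gF'
  obtain ⟨K₂, c₂, hK₂, hc₂, b₂⟩ := exists_expBounded_of_expGrowth
    fun q : (U × V) × (U × V) => gF'' q.1 q.2
  refine integral_le_integral_of_covariance (K := K₀ + K₁ + K₂) (c := c₀ + c₁ + c₂)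
    (by positivity) (by positivity)
    (F := fun z => invExpSum β z ^ θ) (b₀.mono hK₀ (by linarith) (by linarith))
    (fun i => (b₁ i).mono hK₁ (by linarith) (by linarith))
    (fun i j => (b₂ (i, j)).mono hK₂ (by linarith) (by linarith))
    hd hd' x y hxy fun z => ?_
  refine Finset.sum_nonpos fun i _ => Finset.sum_nonpos fun j _ => ?_
  by_cases hij : i.2 = j.2
  · rw [heq i j hij, sub_self, zero_mul]
  · refine mul_nonpos_of_nonneg_of_nonpos (sub_nonneg.2 (hne i j hij)) ?_
    have hij' : i ≠ j := fun h => hij (by rw [h])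
    simp only [hij, hij', if_false]
    have p0 : 0 < invExpSum β z ^ θ := Real.rpow_pos_of_pos (invExpSum_pos β z) _
    have p1 := inv_pos.2 (invExpSum_pos β z)
    have p2 := Real.exp_pos (β * z i)
    have p3 := Real.exp_pos (β * z j)
    have p4 := inv_pos.2 (expSum_pos β i.2 z)
    have p5 := inv_pos.2 (expSum_pos β j.2 z)
    have : 0 ≤ θ * β ^ 2 * (1 - θ) * (invExpSum β z ^ θ * (invExpSum β z)⁻¹ ^ 2 *
        Real.exp (β * z i) * Real.exp (β * z j) * (expSum β i.2 z)⁻¹ ^ 2 *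
        (expSum β j.2 z)⁻¹ ^ 2) := by
      have := sub_nonneg.2 h1
      positivity
    refine le_trans (le_of_eq ?_) (neg_nonpos.2 this)
    ring

end SoftMinMax

/-- **Gordon's comparison inequality**, in exponential form. If the Gaussian processes `X` and `Y`
have the same covariance within each `v`, and `X` has the larger covariance across different `v`,
then `E exp (-l min_v max_u X) ≤ E exp (-l min_v max_u Y)`. Here `f` is an upper bound of
`min_v max_u X` and `g` a lower bound of `min_v max_u Y`. -/
theorem integral_exp_neg_le_of_covariance {κ U V : Type*} [Fintype κ] [Fintype U] [Fintype V]
    [Nonempty U] [Nonempty V] {l : ℝ} (hl : 0 < l) (x y : U × V → κ → ℝ)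
    (hxy : ∀ i j, ∑ k, x i k * y j k = 0)
    (hne : ∀ i j, i.2 ≠ j.2 → ∑ k, y i k * y j k ≤ ∑ k, x i k * x j k)
    (heq : ∀ i j, i.2 = j.2 → ∑ k, y i k * y j k = ∑ k, x i k * x j k) (f g : (κ → ℝ) → ℝ)
    (hf : ∀ w, ∃ v, ∀ u, ∑ k, x (u, v) k * w k ≤ f w)
    (hg : ∀ w v, ∃ u, g w ≤ ∑ k, y (u, v) k * w k)
    (hfi : Integrable (fun w => Real.exp (-l * f w)) (stdGaussian κ))
    (hgi : Integrable (fun w => Real.exp (-l * g w)) (stdGaussian κ)) :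
    ∫ w, Real.exp (-l * f w) ∂stdGaussian κ ≤ ∫ w, Real.exp (-l * g w) ∂stdGaussian κ := by
  classical
  set N : ℝ := (Fintype.card U : ℝ)
  set M : ℝ := (Fintype.card V : ℝ)
  have hN : 0 < N := Nat.cast_pos.2 Fintype.card_pos
  have hM : 0 < M := Nat.cast_pos.2 Fintype.card_pos
  -- the comparison up to factors that tend to `1` as `θ → 0`
  have key : ∀ θ ∈ Set.Ioc (0 : ℝ) 1, N⁻¹ ^ θ * ∫ w, Real.exp (-l * f w) ∂stdGaussian κ ≤
      M ^ θ * ∫ w, Real.exp (-l * g w) ∂stdGaussian κ := by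
    rintro θ ⟨h0, h1⟩
    have hβ : 0 < l / θ := by positivity
    have hlθ : l / θ * θ = l := by field_simp
    have hG := expGrowth_rpow_invExpSum (U := U) (V := V) (l / θ) h0.le h1
    obtain ⟨K, c, hK, hc, hb⟩ := hG
    have hint : ∀ z : U × V → κ → ℝ, Integrable (fun w => invExpSum (l / θ)
        (fun i => ∑ k, z i k * w k) ^ θ) (stdGaussian κ) := fun z => by
      have := hb.integrable_interp hK hc z z 0
      have e0 : interp z z 0 = fun w i => ∑ k, z i k * w k := by funext w i; simp [interp]
      rwa [e0] at this
    rw [← integral_const_mul, ← integral_const_mul]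
    refine (integral_mono (hfi.const_mul _) (hint x) fun w => ?_).trans
      ((integral_rpow_invExpSum_le h0.le h1 x y hxy hne heq).trans
        (integral_mono (hint y) (hgi.const_mul _) fun w => ?_))
    · obtain ⟨v, hv⟩ := hf w
      have e : Real.exp (-l * f w) = (Real.exp (-(l / θ) * f w)) ^ θ := by
        rw [← Real.exp_mul]; congr 1; linear_combination -f w * hlθ.symm
      simp only
      rw [e, ← Real.mul_rpow (by positivity) (by positivity)]
      refine Real.rpow_le_rpow (by positivity) ?_ h0.le
      refine le_trans ?_ (Finset.single_le_sum (f := fun v => (expSum (l / θ) v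
        fun i => ∑ k, x i k * w k)⁻¹) (fun v _ => (inv_pos.2 (expSum_pos _ v _)).le)
        (Finset.mem_univ v))
      rw [neg_mul, Real.exp_neg, ← mul_inv]
      refine inv_anti₀ (expSum_pos _ _ _) ?_
      refine (Finset.sum_le_card_nsmul _ _ (Real.exp (l / θ * f w)) fun u _ => ?_).trans_eq ?_
      · exact Real.exp_le_exp.2 (mul_le_mul_of_nonneg_left (hv u) hβ.le)
      · simp [N]
    · have e : Real.exp (-l * g w) = (Real.exp (-(l / θ) * g w)) ^ θ := by
        rw [← Real.exp_mul]; congr 1; linear_combination -g w * hlθ.symm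
      simp only
      rw [e, ← Real.mul_rpow (by positivity) (by positivity)]
      refine Real.rpow_le_rpow (invExpSum_pos _ _).le ?_ h0.le
      refine (Finset.sum_le_card_nsmul _ _ (Real.exp (-(l / θ) * g w)) fun v _ => ?_).trans_eq ?_
      · obtain ⟨u, hu⟩ := hg w v
        rw [neg_mul, Real.exp_neg]
        refine inv_anti₀ (Real.exp_pos _) ?_
        refine le_trans ?_ (Finset.single_le_sum (f := fun u => Real.exp (l / θ *
          ∑ k, y (u, v) k * w k)) (fun _ _ => (Real.exp_pos _).le) (Finset.mem_univ u))
        exact Real.exp_le_exp.2 (mul_le_mul_of_nonneg_left hu hβ.le)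
      · simp [M]
  have lim : ∀ a : ℝ, 0 < a → ∀ I : ℝ, Tendsto (fun θ : ℝ => a ^ θ * I) (𝓝[>] 0) (𝓝 I) := by
    intro a ha I
    have : ContinuousAt (fun θ : ℝ => a ^ θ * I) 0 :=
      (Real.continuousAt_const_rpow ha.ne').mul continuousAt_const
    have h := this.tendsto
    simp only [Real.rpow_zero, one_mul] at h
    exact h.mono_left nhdsWithin_le_nhds
  refine le_of_tendsto_of_tendsto (lim N⁻¹ (inv_pos.2 hN) _) (lim M hM _) ?_
  filter_upwards [Ioc_mem_nhdsGT (zero_lt_one' ℝ)] with θ hθ using key θ hθ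

/-! ### Comparison for Gaussian matrices -/

theorem measurePreserving_comp_inl_inr (A B : Type*) [Fintype A] [Fintype B] :
    MeasurePreserving (fun w : A ⊕ B → ℝ => (w ∘ Sum.inl, w ∘ Sum.inr)) (stdGaussian (A ⊕ B))
      ((stdGaussian A).prod (stdGaussian B)) :=
  measurePreserving_sumPiEquivProdPi (X := fun _ : A ⊕ B => ℝ) (fun _ => gaussianReal 0 1)

theorem integrable_mul_comp_inl_inr {A B : Type*} [Fintype A] [Fintype B] {f : (A → ℝ) → ℝ}
    {g : (B → ℝ) → ℝ} (hf : Integrable f (stdGaussian A)) (hg : Integrable g (stdGaussian B)) :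
    Integrable (fun w : A ⊕ B → ℝ => f (w ∘ Sum.inl) * g (w ∘ Sum.inr)) (stdGaussian (A ⊕ B)) :=
  (measurePreserving_comp_inl_inr A B).integrable_comp_of_integrable (hf.mul_prod hg)

theorem integral_mul_comp_inl_inr {A B : Type*} [Fintype A] [Fintype B] {f : (A → ℝ) → ℝ}
    {g : (B → ℝ) → ℝ} (hf : Integrable f (stdGaussian A)) (hg : Integrable g (stdGaussian B)) :
    ∫ w, f (w ∘ Sum.inl) * g (w ∘ Sum.inr) ∂stdGaussian (A ⊕ B) =
      (∫ w, f w ∂stdGaussian A) * ∫ w, g w ∂stdGaussian B := by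
  have key := measurePreserving_comp_inl_inr A B
  rw [← integral_prod_mul f g]
  have := integral_map (μ := stdGaussian (A ⊕ B))
    (f := fun q : (A → ℝ) × (B → ℝ) => f q.1 * g q.2) key.measurable.aemeasurable
    (by rw [key.map_eq]; exact (hf.mul_prod hg).aestronglyMeasurable)
  rw [key.map_eq] at this
  exact this.symm

theorem integrable_exp_mul_eval {κ : Type*} [Fintype κ] (k : κ) (l : ℝ) :
    Integrable (fun w => Real.exp (l * w k)) (stdGaussian κ) :=
  integrable_comp_eval (μ := fun _ : κ => gaussianReal 0 1) (f := fun x => Real.exp (l * x))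
    (integrable_exp_mul_gaussianReal l)

theorem integral_exp_mul_eval {κ : Type*} [Fintype κ] (k : κ) (l : ℝ) :
    ∫ w, Real.exp (l * w k) ∂stdGaussian κ = Real.exp (l ^ 2 / 2) := by
  rw [integral_comp_eval (μ := fun _ : κ => gaussianReal 0 1) (f := fun x => Real.exp (l * x))
    (integrable_exp_mul_gaussianReal l).aestronglyMeasurable]
  have := congr_fun (mgf_fun_id_gaussianReal (μ := 0) (v := 1)) l
  simpa [mgf] using this

theorem sum_mul_le_one {σ : Type*} [Fintype σ] {c d : σ → ℝ} (hc : ∑ k, c k ^ 2 = 1)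
    (hd : ∑ k, d k ^ 2 = 1) : ∑ k, c k * d k ≤ 1 := by
  have : 2 * ∑ k, c k * d k ≤ ∑ k, c k ^ 2 + ∑ k, d k ^ 2 := by
    rw [Finset.mul_sum, ← Finset.sum_add_distrib]
    exact Finset.sum_le_sum fun k _ => by nlinarith [sq_nonneg (c k - d k)]
  linarith

/-- Gordon's inequality for a Gaussian matrix `G`: the bilinear process `⟨a, G b⟩`, together with an
independent Gaussian variable (the source of the factor `exp (l² / 2)`), is compared with the
decoupled process `⟨a, g⟩ + ⟨b, h⟩`. -/
theorem integral_exp_neg_bilin_le {m q U V : Type*} [Fintype m] [Fintype q] [Fintype U] [Fintype V]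
    [Nonempty U] [Nonempty V] {l : ℝ} (hl : 0 < l) (a : U × V → m → ℝ) (b : V → q → ℝ)
    (ha : ∀ i, ∑ k, a i k ^ 2 = 1) (hb : ∀ v, ∑ k, b v k ^ 2 = 1) (φ : (m × q → ℝ) → ℝ)
    (ψ : (m → ℝ) → ℝ) (χ : (q → ℝ) → ℝ)
    (hφ : ∀ G, ∃ v, ∀ u, ∑ i, ∑ j, a (u, v) i * b v j * G (i, j) ≤ φ G)
    (hψ : ∀ g h v, ∃ u, ψ g + χ h ≤ ∑ i, a (u, v) i * g i + ∑ j, b v j * h j)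
    (iφ : Integrable (fun G => Real.exp (-l * φ G)) (stdGaussian (m × q)))
    (iψ : Integrable (fun g => Real.exp (-l * ψ g)) (stdGaussian m))
    (iχ : Integrable (fun h => Real.exp (-l * χ h)) (stdGaussian q)) :
    (∫ G, Real.exp (-l * φ G) ∂stdGaussian (m × q)) * Real.exp (l ^ 2 / 2) ≤
      (∫ g, Real.exp (-l * ψ g) ∂stdGaussian m) * ∫ h, Real.exp (-l * χ h) ∂stdGaussian q := by
  let x : U × V → (m × q) ⊕ (Unit ⊕ (m ⊕ q)) → ℝ := fun i =>
    Sum.elim (fun k => a i k.1 * b i.2 k.2) (Sum.elim (fun _ => 1) fun _ => 0)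
  let y : U × V → (m × q) ⊕ (Unit ⊕ (m ⊕ q)) → ℝ := fun i =>
    Sum.elim (fun _ => 0) (Sum.elim (fun _ => 0) (Sum.elim (a i) (b i.2)))
  have hxx : ∀ i j, ∑ k, x i k * x j k =
      (∑ k, a i k * a j k) * (∑ k, b i.2 k * b j.2 k) + 1 := by
    intro i j
    simp only [x, Fintype.sum_sum_type, Sum.elim_inl, Sum.elim_inr, Fintype.sum_prod_type,
      Finset.sum_mul_sum, mul_zero, Finset.sum_const_zero]
    simp only [Finset.univ_unique, Finset.sum_const, Finset.card_singleton, one_smul, mul_one,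
      add_zero]
    congr 1
    exact Finset.sum_congr rfl fun k _ => Finset.sum_congr rfl fun k' _ => by ring
  have hyy : ∀ i j, ∑ k, y i k * y j k = ∑ k, a i k * a j k + ∑ k, b i.2 k * b j.2 k := by
    intro i j
    simp [y, Fintype.sum_sum_type]
  have key := integral_exp_neg_le_of_covariance hl x y
    (fun i j => by simp [x, y, Fintype.sum_sum_type])
    (fun i j _ => by
      rw [hxx, hyy]
      nlinarith [sum_mul_le_one (ha i) (ha j), sum_mul_le_one (hb i.2) (hb j.2)])
    (fun i j hij => by
      rw [hxx, hyy, hij]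
      have : ∑ k, b j.2 k * b j.2 k = 1 := by rw [← hb j.2]; simp only [sq]
      rw [this]; ring)
    (fun w => φ (w ∘ Sum.inl) + w (Sum.inr (Sum.inl ())))
    (fun w => ψ (w ∘ Sum.inr ∘ Sum.inr ∘ Sum.inl) + χ (w ∘ Sum.inr ∘ Sum.inr ∘ Sum.inr))
    (fun w => by
      obtain ⟨v, hv⟩ := hφ (w ∘ Sum.inl)
      refine ⟨v, fun u => ?_⟩
      have := hv u
      simpa [x, Fintype.sum_sum_type, Fintype.sum_prod_type] using this)
    (fun w v => by
      obtain ⟨u, hu⟩ := hψ (w ∘ Sum.inr ∘ Sum.inr ∘ Sum.inl) (w ∘ Sum.inr ∘ Sum.inr ∘ Sum.inr) v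
      exact ⟨u, by simpa [y, Fintype.sum_sum_type] using hu⟩)
  have e1 : (fun w : (m × q) ⊕ (Unit ⊕ (m ⊕ q)) → ℝ =>
      Real.exp (-l * (φ (w ∘ Sum.inl) + w (Sum.inr (Sum.inl ()))))) =
      fun w => Real.exp (-l * φ (w ∘ Sum.inl)) *
        (fun w' : Unit ⊕ (m ⊕ q) → ℝ => Real.exp (-l * w' (Sum.inl ()))) (w ∘ Sum.inr) := by
    funext w
    rw [mul_add, Real.exp_add]
    rfl
  have e2 : (fun w : (m × q) ⊕ (Unit ⊕ (m ⊕ q)) → ℝ =>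
      Real.exp (-l * (ψ (w ∘ Sum.inr ∘ Sum.inr ∘ Sum.inl) + χ (w ∘ Sum.inr ∘ Sum.inr ∘ Sum.inr)))) =
      fun w => (fun _ => 1) (w ∘ Sum.inl) * (fun w₁ : Unit ⊕ (m ⊕ q) → ℝ =>
        (fun _ => 1) (w₁ ∘ Sum.inl) * (fun w₂ : m ⊕ q → ℝ =>
        Real.exp (-l * ψ (w₂ ∘ Sum.inl)) * Real.exp (-l * χ (w₂ ∘ Sum.inr))) (w₁ ∘ Sum.inr))
          (w ∘ Sum.inr) := by
    funext w
    simp only [one_mul]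
    rw [mul_add, Real.exp_add]
    rfl
  have i1 := integrable_exp_mul_eval (κ := Unit ⊕ (m ⊕ q)) (Sum.inl ()) (-l)
  have i2 := integrable_mul_comp_inl_inr iψ iχ
  have i3 := integrable_mul_comp_inl_inr (A := Unit) (f := fun _ => (1 : ℝ))
    (integrable_const _) i2
  have key' := key (by rw [e1]; exact integrable_mul_comp_inl_inr iφ i1)
    (by rw [e2]
        exact integrable_mul_comp_inl_inr (f := fun _ => (1 : ℝ)) (integrable_const _) i3)
  rw [e1, e2, integral_mul_comp_inl_inr iφ i1,
    integral_mul_comp_inl_inr (f := fun _ => (1 : ℝ)) (integrable_const _) i3,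
    integral_mul_comp_inl_inr (A := Unit) (f := fun _ => (1 : ℝ)) (integrable_const _) i2,
    integral_mul_comp_inl_inr iψ iχ, integral_exp_mul_eval] at key'
  simpa using key'

/-! ### Exponential moments of the norm of a Gaussian vector -/

/-- The Euclidean norm of the restriction of `h` to the coordinates in `S`. -/
noncomputable def normOn {q : Type*} (S : Finset q) (h : q → ℝ) : ℝ := √(∑ k ∈ S, h k ^ 2)

theorem continuous_normOn {q : Type*} (S : Finset q) : Continuous (normOn S) := by
  unfold normOn; fun_prop

theorem normOn_nonneg {q : Type*} (S : Finset q) (h : q → ℝ) : 0 ≤ normOn S h := Real.sqrt_nonneg _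

theorem sq_normOn {q : Type*} (S : Finset q) (h : q → ℝ) : normOn S h ^ 2 = ∑ k ∈ S, h k ^ 2 :=
  Real.sq_sqrt (Finset.sum_nonneg fun _ _ => sq_nonneg _)

theorem integrable_exp_sq {μ : ℝ} (hμ : μ < 1) :
    Integrable (fun x => Real.exp (μ / 2 * x ^ 2)) (gaussianReal 0 1) := by
  rw [integrable_gaussianReal_iff]
  refine ((integrable_exp_neg_mul_sq (by linarith : 0 < (1 - μ) / 2)).const_mul
    (√(2 * Real.pi))⁻¹).congr (ae_of_all _ fun x => ?_)
  simp only [gaussianPDFReal, NNReal.coe_one, mul_one, sub_zero]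
  rw [mul_assoc, ← Real.exp_add]
  congr 2; ring

theorem integral_exp_sq {μ : ℝ} (hμ : μ < 1) :
    ∫ x, Real.exp (μ / 2 * x ^ 2) ∂gaussianReal 0 1 = (√(1 - μ))⁻¹ := by
  rw [integral_gaussianReal_eq_integral_smul one_ne_zero]
  have h : ∀ x : ℝ, gaussianPDFReal 0 1 x • Real.exp (μ / 2 * x ^ 2) =
      (√(2 * Real.pi))⁻¹ * Real.exp (-((1 - μ) / 2) * x ^ 2) := by
    intro x
    simp only [gaussianPDFReal, NNReal.coe_one, mul_one, sub_zero, smul_eq_mul]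
    rw [mul_assoc, ← Real.exp_add]
    congr 2; ring
  simp only [h]
  have h1 : 0 < 1 - μ := by linarith
  rw [integral_const_mul, integral_gaussian, ← Real.sqrt_inv, ← Real.sqrt_inv,
    ← Real.sqrt_mul (by positivity)]
  congr 1
  have := Real.pi_pos
  field_simp

theorem integrable_exp_sum_sq {q : Type*} [Fintype q] {μ : ℝ} (hμ : μ < 1) (S : Finset q) :
    Integrable (fun h => Real.exp (μ / 2 * ∑ k ∈ S, h k ^ 2)) (stdGaussian q) := by
  classical
  have := Integrable.fintype_prod (ι := q) (μ := fun _ : q => gaussianReal 0 1)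
    (f := fun k x => if k ∈ S then Real.exp (μ / 2 * x ^ 2) else 1) (fun k => by
      by_cases hk : k ∈ S
      · simpa [hk] using integrable_exp_sq hμ
      · simp [hk])
  refine this.congr (ae_of_all _ fun h => ?_)
  simp [Finset.prod_ite_mem, Finset.mul_sum, Real.exp_sum]

theorem integral_exp_sum_sq {q : Type*} [Fintype q] {μ : ℝ} (hμ : μ < 1) (S : Finset q) :
    ∫ h, Real.exp (μ / 2 * ∑ k ∈ S, h k ^ 2) ∂stdGaussian q = (√(1 - μ))⁻¹ ^ S.card := by
  classical
  have := integral_fintype_prod_eq_prod (ι := q) (𝕜 := ℝ) (μ := fun _ : q => gaussianReal 0 1)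
    (fun k (x : ℝ) => if k ∈ S then Real.exp (μ / 2 * x ^ 2) else 1)
  have e : ∀ k : q, ∫ x, (if k ∈ S then Real.exp (μ / 2 * x ^ 2) else 1) ∂gaussianReal 0 1 =
      if k ∈ S then (√(1 - μ))⁻¹ else 1 := fun k => by
    by_cases hk : k ∈ S
    · simpa [hk] using integral_exp_sq hμ
    · simp [hk]
  simp only [e, Finset.prod_ite_mem, Finset.univ_inter, Finset.prod_const] at this
  rw [← this]
  refine integral_congr_ae (ae_of_all _ fun h => ?_)
  simp [Finset.mul_sum, Real.exp_sum]

/-- An exponential bound for the moment in `integral_exp_sum_sq`, with `c = 1 - μ` and `N = S.card`.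
The choice `c = √N / x` turns the Chernoff bound for a chi-square variable into a Gaussian bound
around `√N`. -/
theorem inv_sqrt_pow_le {N : ℕ} (c : ℝ) :
    (√c)⁻¹ ^ N ≤ Real.exp (N / 2 * (c⁻¹ - 1)) := by
  have h1 : (√c)⁻¹ = √(c⁻¹) := (Real.sqrt_inv c).symm
  have h2 : c⁻¹ ≤ Real.exp (c⁻¹ - 1) := by linarith [Real.add_one_le_exp (c⁻¹ - 1)]
  have h3 : √(c⁻¹) ≤ Real.exp ((c⁻¹ - 1) / 2) := by
    rw [Real.exp_half]
    exact Real.sqrt_le_sqrt h2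
  rw [h1]
  refine (pow_le_pow_left₀ (Real.sqrt_nonneg _) h3 N).trans_eq ?_
  rw [← Real.exp_nat_mul]
  congr 1; ring

theorem mul_normOn_le {q : Type*} (S : Finset q) (h : q → ℝ) {l a : ℝ} (hl : 0 ≤ l) (ha : 0 < a) :
    l * normOn S h ≤ l * a / 2 + l / a / 2 * ∑ k ∈ S, h k ^ 2 := by
  rw [← sq_normOn]
  have : l * a / 2 + l / a / 2 * normOn S h ^ 2 - l * normOn S h
      = l / a / 2 * (normOn S h - a) ^ 2 := by field_simp; ring
  have : 0 ≤ l / a / 2 * (normOn S h - a) ^ 2 := by positivity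
  linarith

theorem integrable_exp_mul_normOn {q : Type*} [Fintype q] (S : Finset q) {l : ℝ} (hl : 0 < l) :
    Integrable (fun h => Real.exp (l * normOn S h)) (stdGaussian q) := by
  have hμ : l / (2 * l) < 1 := by rw [div_lt_one (by positivity)]; linarith
  refine ((integrable_exp_sum_sq hμ S).const_mul (Real.exp (l * (2 * l) / 2))).mono'
    (by have := continuous_normOn S; fun_prop) (ae_of_all _ fun h => ?_)
  rw [Real.norm_eq_abs, abs_of_pos (Real.exp_pos _), ← Real.exp_add]
  exact Real.exp_le_exp.2 (mul_normOn_le S h hl.le (by positivity))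

/-- The moment generating function of the norm of a Gaussian vector in dimension `N` is at most that
of a Gaussian variable with mean `√N` and variance `1`. -/
theorem integral_exp_mul_normOn_le {q : Type*} [Fintype q] (S : Finset q) {l : ℝ} (hl : 0 < l) :
    ∫ h, Real.exp (l * normOn S h) ∂stdGaussian q ≤
      Real.exp (l * √(S.card : ℝ) + l ^ 2 / 2) := by
  rcases S.eq_empty_or_nonempty with rfl | hS
  · have : Real.exp 0 ≤ Real.exp (l ^ 2 / 2) := Real.exp_le_exp.2 (by positivity)
    simpa [normOn] using this
  set r := √(S.card : ℝ) with hr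
  have hr0 : 0 < r := Real.sqrt_pos.2 (by exact_mod_cast hS.card_pos)
  have hr2 : (S.card : ℝ) = r ^ 2 := (Real.sq_sqrt (by positivity)).symm
  clear_value r
  clear hr
  have ha : 0 < r + l := by positivity
  have hc : 1 - l / (r + l) = r / (r + l) := by field_simp; ring
  have hμ : l / (r + l) < 1 := by rw [div_lt_one ha]; linarith
  calc ∫ h, Real.exp (l * normOn S h) ∂stdGaussian q
      ≤ ∫ h, Real.exp (l * (r + l) / 2) * Real.exp (l / (r + l) / 2 * ∑ k ∈ S, h k ^ 2)
          ∂stdGaussian q := by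
        refine integral_mono (integrable_exp_mul_normOn S hl)
          ((integrable_exp_sum_sq hμ S).const_mul _) fun h => ?_
        simp only
        rw [← Real.exp_add]
        exact Real.exp_le_exp.2 (mul_normOn_le S h hl.le ha)
    _ ≤ Real.exp (l * (r + l) / 2) * Real.exp (S.card / 2 * ((r / (r + l))⁻¹ - 1)) := by
        rw [integral_const_mul, integral_exp_sum_sq hμ, hc]
        exact mul_le_mul_of_nonneg_left (inv_sqrt_pow_le _) (Real.exp_pos _).le
    _ = Real.exp (l * r + l ^ 2 / 2) := by
        rw [← Real.exp_add, hr2]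
        congr 1
        field_simp
        ring

theorem integrable_exp_neg_mul_normOn {q : Type*} [Fintype q] (S : Finset q) {l : ℝ} (hl : 0 ≤ l) :
    Integrable (fun h => Real.exp (-l * normOn S h)) (stdGaussian q) := by
  refine (integrable_const (1 : ℝ)).mono' (by have := continuous_normOn S; fun_prop)
    (ae_of_all _ fun h => ?_)
  rw [Real.norm_eq_abs, abs_of_pos (Real.exp_pos _), Real.exp_le_one_iff]
  nlinarith [normOn_nonneg S h]

/-- The lower counterpart of `integral_exp_mul_normOn_le`, up to a factor that is subexponential
when `l` is of order `√N`. The range of the norm is cut into unit steps, and a Chernoff bound is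
used on each step. -/
theorem integral_exp_neg_mul_normOn_le {q : Type*} [Fintype q] (S : Finset q) {l : ℝ}
    (hl : 0 < l) :
    ∫ h, Real.exp (-l * normOn S h) ∂stdGaussian q ≤
      (S.card + 2) * Real.exp l * Real.exp (-l * √(S.card : ℝ) + l ^ 2 / 2) := by
  set N := S.card with hN
  set r := √(N : ℝ) with hr
  have hr0 : 0 ≤ r := Real.sqrt_nonneg _
  have hr2 : (N : ℝ) = r ^ 2 := (Real.sq_sqrt (by positivity)).symm
  have hrN : r ≤ N := by
    rcases Nat.eq_zero_or_pos N with h | h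
    · rw [hr, h]; simp
    · have : (1 : ℝ) ≤ N := by exact_mod_cast h
      rw [hr]
      exact Real.sqrt_le_self_iff.2 (Or.inr this)
  clear_value r
  clear hr
  set B := Real.exp l * Real.exp (-l * r + l ^ 2 / 2) with hB
  have hB1 : Real.exp (-l * r) ≤ B := by
    rw [hB, ← Real.exp_add]
    exact Real.exp_le_exp.2 (by nlinarith [sq_nonneg l])
  -- the step functions; `j + 1` runs over the right end points of the unit steps
  let T : ℕ → (q → ℝ) → ℝ := fun j h => if (j : ℝ) + 1 < r then
    Real.exp (-l * j + (r - (j + 1)) * (j + 1) / 2) *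
      Real.exp ((1 - r / (j + 1)) / 2 * ∑ k ∈ S, h k ^ 2) else Real.exp (-l * (r - 1))
  have hT0 : ∀ j h, 0 ≤ T j h := fun j h => by
    simp only [T]; split_ifs <;> positivity
  have hμ : ∀ j : ℕ, (j : ℝ) + 1 < r → 1 - r / (j + 1) < 1 := fun j hj => by
    have : 0 < r / (j + 1) := by
      have : (0 : ℝ) < j + 1 := by positivity
      exact div_pos (this.trans hj) this
    linarith
  have hTi : ∀ j, Integrable (T j) (stdGaussian q) := fun j => by
    by_cases hj : (j : ℝ) + 1 < r
    · simp only [T, hj, if_true]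
      exact (integrable_exp_sum_sq (hμ j hj) S).const_mul _
    · simp only [T, hj, if_false]
      exact integrable_const _
  have hTle : ∀ j, ∫ h, T j h ∂stdGaussian q ≤ B := fun j => by
    by_cases hj : (j : ℝ) + 1 < r
    · simp only [T, hj, if_true]
      have hj0 : (0 : ℝ) < j + 1 := by positivity
      have hrp : 0 < r := hj0.trans hj
      rw [integral_const_mul, integral_exp_sum_sq (hμ j hj)]
      have := inv_sqrt_pow_le (N := N) (r / (j + 1))
      rw [sub_sub_cancel]
      refine (mul_le_mul_of_nonneg_left this (Real.exp_pos _).le).trans ?_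
      rw [← Real.exp_add, hB, ← Real.exp_add]
      refine Real.exp_le_exp.2 ?_
      rw [hr2]
      have e : r ^ 2 / 2 * ((r / ((j : ℝ) + 1))⁻¹ - 1) = (r * (j + 1) - r ^ 2) / 2 := by
        field_simp
      rw [e]
      nlinarith [sq_nonneg (r - (j + 1) - l)]
    · simp only [T, hj, if_false]
      rw [integral_const, probReal_univ, one_smul]
      rw [hB, ← Real.exp_add]
      exact Real.exp_le_exp.2 (by nlinarith [sq_nonneg l])
  have hpt : ∀ h, Real.exp (-l * normOn S h) ≤
      Real.exp (-l * r) + ∑ j ∈ Finset.range (N + 1), T j h := by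
    intro h
    set x := normOn S h with hx
    have hx0 : 0 ≤ x := normOn_nonneg S h
    rcases le_or_gt r x with hrx | hrx
    · have h1 : Real.exp (-l * x) ≤ Real.exp (-l * r) := Real.exp_le_exp.2 (by nlinarith)
      have h2 := Finset.sum_nonneg (s := Finset.range (N + 1)) fun j _ => hT0 j h
      linarith
    · have hj1 := Nat.floor_le hx0
      have hj2 := Nat.lt_floor_add_one x
      set j := ⌊x⌋₊ with hjdef
      have hjN : j ∈ Finset.range (N + 1) := by
        rw [Finset.mem_range]
        have : (j : ℝ) < N + 1 := by linarith
        exact_mod_cast this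
      have h1 := Finset.single_le_sum (f := fun j => T j h) (fun j _ => hT0 j h) hjN
      have h2 : Real.exp (-l * x) ≤ T j h := by
        simp only [T]
        split_ifs with hj
        · rw [← Real.exp_add, ← sq_normOn, ← hx]
          refine Real.exp_le_exp.2 ?_
          have hj0 : (0 : ℝ) < j + 1 := by positivity
          have e : (1 - r / ((j : ℝ) + 1)) / 2 * x ^ 2 =
              -((r - (j + 1)) / 2 * (x ^ 2 / (j + 1))) := by field_simp; ring
          have h3 : x ^ 2 / (j + 1) ≤ j + 1 := by rw [div_le_iff₀ hj0]; nlinarith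
          rw [e]
          nlinarith [mul_le_mul_of_nonneg_left h3 (by linarith : 0 ≤ (r - (j + 1)) / 2),
            mul_le_mul_of_nonneg_left hj1 hl.le]
        · refine Real.exp_le_exp.2 ?_
          nlinarith
      have h3 := Real.exp_pos (-l * r)
      linarith
  have hTs : Integrable (fun h => ∑ j ∈ Finset.range (N + 1), T j h) (stdGaussian q) :=
    integrable_finsetSum _ fun j _ => hTi j
  calc ∫ h, Real.exp (-l * normOn S h) ∂stdGaussian q
      ≤ ∫ h, (Real.exp (-l * r) + ∑ j ∈ Finset.range (N + 1), T j h) ∂stdGaussian q :=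
        integral_mono (integrable_exp_neg_mul_normOn S hl.le) ((integrable_const _).add hTs) hpt
    _ = Real.exp (-l * r) + ∑ j ∈ Finset.range (N + 1), ∫ h, T j h ∂stdGaussian q := by
        rw [integral_add (integrable_const _) hTs, integral_finsetSum _ fun j _ => hTi j]
        simp
    _ ≤ B + ∑ j ∈ Finset.range (N + 1), B := add_le_add hB1 (Finset.sum_le_sum fun j _ => hTle j)
    _ = (N + 2) * Real.exp l * Real.exp (-l * r + l ^ 2 / 2) := by
        rw [hB]
        simp
        ring

/-! ### Sparse singular values of a Gaussian matrix -/

/-- The unit vectors supported in a set of exactly `s` coordinates. -/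
def sparseSphere (q : Type*) [Fintype q] (s : ℕ) : Set (q → ℝ) :=
  {v | ∑ j, v j ^ 2 = 1 ∧ ∃ S : Finset q, S.card = s ∧ ∀ j ∉ S, v j = 0}

/-- The Euclidean norm of `G v`. -/
noncomputable def normMul {m q : Type*} [Fintype m] [Fintype q] (v : q → ℝ) (G : m × q → ℝ) : ℝ :=
  √(∑ i, (∑ j, G (i, j) * v j) ^ 2)

/-- The bilinear form `⟨u, G v⟩`. -/
def bilin {m q : Type*} [Fintype m] [Fintype q] (u : m → ℝ) (v : q → ℝ) (G : m × q → ℝ) : ℝ :=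
  ∑ i, ∑ j, u i * v j * G (i, j)

theorem bilin_eq {m q : Type*} [Fintype m] [Fintype q] (u : m → ℝ) (v : q → ℝ) (G : m × q → ℝ) :
    bilin u v G = ∑ i, u i * ∑ j, G (i, j) * v j := by
  unfold bilin
  refine Finset.sum_congr rfl fun i _ => ?_
  rw [Finset.mul_sum]
  exact Finset.sum_congr rfl fun j _ => by ring

theorem bilin_le_normMul {m q : Type*} [Fintype m] [Fintype q] {u : m → ℝ}
    (hu : ∑ i, u i ^ 2 = 1) (v : q → ℝ) (G : m × q → ℝ) : bilin u v G ≤ normMul v G := by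
  rw [bilin_eq]
  refine (Real.sum_mul_le_sqrt_mul_sqrt _ _ _).trans_eq ?_
  rw [hu, Real.sqrt_one, one_mul]
  rfl

theorem exists_bilin_eq_normMul {m q : Type*} [Fintype m] [Fintype q] {v : q → ℝ}
    {G : m × q → ℝ} (h : 0 < normMul v G) :
    ∃ u : m → ℝ, ∑ i, u i ^ 2 = 1 ∧ bilin u v G = normMul v G := by
  have h2 : normMul v G ^ 2 = ∑ i, (∑ j, G (i, j) * v j) ^ 2 :=
    Real.sq_sqrt (Finset.sum_nonneg fun _ _ => sq_nonneg _)
  refine ⟨fun i => (∑ j, G (i, j) * v j) / normMul v G, ?_, ?_⟩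
  · simp only [div_pow, ← Finset.sum_div]
    rw [← h2, div_self (by positivity)]
  · rw [bilin_eq]
    simp only [div_mul_eq_mul_div, ← Finset.sum_div, ← sq]
    rw [← h2]
    field_simp

theorem sum_mul_le_normOn {q : Type*} [Fintype q] {S : Finset q} {v : q → ℝ}
    (hv : ∑ j, v j ^ 2 = 1) (hS : ∀ j ∉ S, v j = 0) (h : q → ℝ) :
    ∑ j, v j * h j ≤ normOn S h := by
  have h1 : ∑ j, v j * h j = ∑ j ∈ S, v j * h j :=
    (Finset.sum_subset (Finset.subset_univ S) fun j _ hj => by rw [hS j hj, zero_mul]).symm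
  have h2 : ∑ j, v j ^ 2 = ∑ j ∈ S, v j ^ 2 :=
    (Finset.sum_subset (Finset.subset_univ S) fun j _ hj => by rw [hS j hj]; ring).symm
  rw [h1]
  refine (Real.sum_mul_le_sqrt_mul_sqrt _ _ _).trans_eq ?_
  rw [← h2, hv, Real.sqrt_one, one_mul]
  rfl

/-- The supremum over `s`-sparse unit vectors costs a union bound on the decoupled side only, where
it concerns the norms of `s` coordinates of a Gaussian vector. -/
theorem measureReal_exists_lt_le {m q U V : Type*} [Fintype m] [Fintype q] [Fintype U] [Fintype V]
    [Nonempty U] [Nonempty V] {l : ℝ} (hl : 0 < l) {s : ℕ} (a : U × V → m → ℝ) (b : V → q → ℝ)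
    (ha : ∀ i, ∑ k, a i k ^ 2 = 1) (hb : ∀ v, b v ∈ sparseSphere q s)
    (Φ : V → (m × q → ℝ) → ℝ) (hΦ : ∀ v, Continuous (Φ v))
    (hΦle : ∀ u v G, bilin (a (u, v)) (b v) G ≤ Φ v G) (ψ : (m → ℝ) → ℝ)
    (hψ : ∀ g v, ∃ u, ψ g ≤ ∑ i, a (u, v) i * g i)
    (iψ : Integrable (fun g => Real.exp (-l * ψ g)) (stdGaussian m)) (t : ℝ) :
    (stdGaussian (m × q)).real {G | ∃ v, Φ v G < t} ≤
      Real.exp (l * t) * (∫ g, Real.exp (-l * ψ g) ∂stdGaussian m) *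
        ((Fintype.card q).choose s * Real.exp (l * √(s : ℝ))) := by
  classical
  obtain ⟨v₀⟩ := ‹Nonempty V›
  have : Nonempty V := ⟨v₀⟩
  set A : Set (m × q → ℝ) := {G | ∃ v, Φ v G < t} with hA
  have hAm : MeasurableSet A := by
    rw [hA, Set.ofPred_exists]
    exact MeasurableSet.iUnion fun v => (isOpen_lt (hΦ v) continuous_const).measurableSet
  let φ : (m × q → ℝ) → ℝ := fun G => if G ∈ A then t else Φ v₀ G
  have hφm : Measurable φ := Measurable.ite hAm measurable_const (hΦ v₀).measurable
  have hφt : ∀ G, t ≤ φ G := fun G => by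
    by_cases hG : G ∈ A
    · simp [φ, hG]
    · simp only [φ, hG, if_false]
      exact not_lt.1 fun h => hG ⟨v₀, h⟩
  have iφ : Integrable (fun G => Real.exp (-l * φ G)) (stdGaussian (m × q)) := by
    refine (integrable_const (Real.exp (-l * t))).mono' (by fun_prop) (ae_of_all _ fun G => ?_)
    rw [Real.norm_eq_abs, abs_of_pos (Real.exp_pos _)]
    exact Real.exp_le_exp.2 (by nlinarith [hφt G])
  let Z : (q → ℝ) → ℝ := fun h => ∑ S ∈ Finset.powersetCard s Finset.univ,
    Real.exp (l * normOn S h)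
  have hZ : ∀ {S : Finset q} (h : q → ℝ), S.card = s → Real.exp (l * normOn S h) ≤ Z h :=
    fun h hS =>
    Finset.single_le_sum (f := fun S => Real.exp (l * normOn S h)) (fun _ _ => (Real.exp_pos _).le)
      (Finset.mem_powersetCard.2 ⟨Finset.subset_univ _, hS⟩)
  have hZ0 : ∀ h, 0 < Z h := fun h => by
    obtain ⟨S, hS, _⟩ := (hb v₀).2
    exact (Real.exp_pos _).trans_le (hZ h hS)
  -- a stand-in for `-max_S ‖h_S‖` whose exponential moment is a sum over `S`
  let χ : (q → ℝ) → ℝ := fun h => -(Real.log (Z h) / l)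
  have hχ : ∀ h, Real.exp (-l * χ h) = Z h := fun h => by
    have : -l * χ h = Real.log (Z h) := by simp only [χ]; field_simp
    rw [this, Real.exp_log (hZ0 h)]
  have hχle : ∀ {S : Finset q} (h : q → ℝ), S.card = s → χ h ≤ -normOn S h := fun {S} h hS => by
    have := Real.log_le_log (Real.exp_pos _) (hZ h hS)
    rw [Real.log_exp] at this
    simp only [χ]
    rw [neg_le_neg_iff, le_div_iff₀ hl]
    linarith
  have iZ : Integrable Z (stdGaussian q) :=
    integrable_finsetSum _ fun S _ => integrable_exp_mul_normOn S hl
  have key := integral_exp_neg_bilin_le hl a b ha (fun v => (hb v).1) φ ψ χ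
    (fun G => by
      by_cases hG : G ∈ A
      · obtain ⟨v, hv⟩ := hG
        refine ⟨v, fun u => (hΦle u v G).trans ?_⟩
        exact hv.le.trans (hφt G)
      · refine ⟨v₀, fun u => (hΦle u v₀ G).trans ?_⟩
        simp [φ, hG])
    (fun g h v => by
      obtain ⟨u, hu⟩ := hψ g v
      obtain ⟨hv1, S, hS, hSv⟩ := hb v
      refine ⟨u, add_le_add hu ?_⟩
      have h1 := sum_mul_le_normOn hv1 hSv fun j => -h j
      have h2 : normOn S (fun j => -h j) = normOn S h := by simp [normOn]
      rw [h2] at h1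
      simp only [mul_neg, Finset.sum_neg_distrib] at h1
      linarith [hχle h hS])
    iφ iψ (by simp only [hχ]; exact iZ)
  simp only [hχ] at key
  have hZle : ∫ h, Z h ∂stdGaussian q ≤
      (Fintype.card q).choose s * Real.exp (l * √(s : ℝ) + l ^ 2 / 2) := by
    rw [integral_finsetSum _ fun S _ => integrable_exp_mul_normOn S hl]
    refine (Finset.sum_le_card_nsmul _ _ (Real.exp (l * √(s : ℝ) + l ^ 2 / 2))
      fun S hS => ?_).trans_eq ?_
    · have := integral_exp_mul_normOn_le S hl
      rwa [(Finset.mem_powersetCard.1 hS).2] at this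
    · rw [Finset.card_powersetCard, Finset.card_univ, nsmul_eq_mul]
  have hmark : (stdGaussian (m × q)).real A * Real.exp (-l * t) ≤
      ∫ G, Real.exp (-l * φ G) ∂stdGaussian (m × q) := by
    have h1 : ∫ G, A.indicator (fun _ => Real.exp (-l * t)) G ∂stdGaussian (m × q) =
        (stdGaussian (m × q)).real A * Real.exp (-l * t) := by
      rw [integral_indicator_const _ hAm, smul_eq_mul]
    rw [← h1]
    refine integral_mono ((integrable_const _).indicator hAm) iφ fun G => ?_
    by_cases hG : G ∈ A
    · simp [φ, hG]
    · simp [hG, Real.exp_nonneg]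
  set I := ∫ g, Real.exp (-l * ψ g) ∂stdGaussian m
  have hI : 0 ≤ I := integral_nonneg fun g => (Real.exp_pos _).le
  have h3 : (stdGaussian (m × q)).real A * Real.exp (-l * t) * Real.exp (l ^ 2 / 2) ≤
      I * ((Fintype.card q).choose s * Real.exp (l * √(s : ℝ) + l ^ 2 / 2)) :=
    (mul_le_mul_of_nonneg_right hmark (Real.exp_pos _).le).trans
      (key.trans (mul_le_mul_of_nonneg_left hZle hI))
  have e1 : Real.exp (l * t) * Real.exp (-l * t) = 1 := by
    rw [← Real.exp_add]; simp
  rw [Real.exp_add] at h3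
  have hp := Real.exp_pos (l ^ 2 / 2)
  have h4 : (stdGaussian (m × q)).real A * Real.exp (-l * t) ≤
      I * ((Fintype.card q).choose s * Real.exp (l * √(s : ℝ))) := by
    refine le_of_mul_le_mul_right (h3.trans_eq ?_) hp
    ring
  calc (stdGaussian (m × q)).real A
      = Real.exp (l * t) * ((stdGaussian (m × q)).real A * Real.exp (-l * t)) := by
        linear_combination (-(stdGaussian (m × q)).real A) * e1
    _ ≤ Real.exp (l * t) * (I * ((Fintype.card q).choose s * Real.exp (l * √(s : ℝ)))) :=
        mul_le_mul_of_nonneg_left h4 (Real.exp_pos _).le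
    _ = _ := by ring

/-- A union over a separable parameter space has the measure of its largest finite subunions. -/
theorem measureReal_exists_lt_le_of_finite {Ω K : Type*} [MeasurableSpace Ω] [TopologicalSpace K]
    [TopologicalSpace.SeparableSpace K] (μ : Measure Ω) [IsFiniteMeasure μ] (Φ : K → Ω → ℝ)
    (hΦ : ∀ ω, Continuous fun k => Φ k ω) {t B : ℝ} (hB : 0 ≤ B)
    (h : ∀ (N : ℕ) (d : Fin (N + 1) → K), μ.real {ω | ∃ i, Φ (d i) ω < t} ≤ B) :
    μ.real {ω | ∃ k, Φ k ω < t} ≤ B := by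
  rcases isEmpty_or_nonempty K with hK | hK
  · simpa using hB
  let s : ℕ → Set Ω := fun N => {ω | ∃ i : Fin (N + 1), Φ (TopologicalSpace.denseSeq K i) ω < t}
  have hs : Monotone s := by
    rintro N M hNM ω ⟨i, hi⟩
    exact ⟨Fin.castLE (by omega) i, hi⟩
  have hsub : {ω | ∃ k, Φ k ω < t} ⊆ ⋃ N, s N := by
    rintro ω ⟨k, hk⟩
    obtain ⟨N, hN⟩ := (TopologicalSpace.denseRange_denseSeq K).exists_mem_open
      (isOpen_lt (hΦ ω) continuous_const) ⟨k, hk⟩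
    exact Set.mem_iUnion.2 ⟨N, Fin.last N, by simpa using hN⟩
  refine (measureReal_mono hsub (measure_ne_top _ _)).trans ?_
  rw [measureReal_def, hs.measure_iUnion]
  refine ENNReal.toReal_le_of_le_ofReal hB (iSup_le fun N => ?_)
  rw [← ENNReal.ofReal_toReal (measure_ne_top μ (s N))]
  exact ENNReal.ofReal_le_ofReal (h N _)

theorem continuous_normMul_left {m q : Type*} [Fintype m] [Fintype q] (G : m × q → ℝ) :
    Continuous fun v => normMul v G := by
  unfold normMul; fun_prop

theorem continuous_normMul_right {m q : Type*} [Fintype m] [Fintype q] (v : q → ℝ) :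
    Continuous fun G : m × q → ℝ => normMul v G := by
  unfold normMul; fun_prop

theorem continuous_bilin {m q : Type*} [Fintype m] [Fintype q] :
    Continuous fun x : ((m → ℝ) × (q → ℝ)) × (m × q → ℝ) => bilin x.1.1 x.1.2 x.2 := by
  unfold bilin; fun_prop

/-- Large deviations of the largest `s`-sparse singular value of a Gaussian matrix. -/
theorem measureReal_lt_normMul_le {m q : Type*} [Fintype m] [Fintype q] (s : ℕ) {t : ℝ}
    (ht : 0 < t) :
    (stdGaussian (m × q)).real {G | ∃ v ∈ sparseSphere q s,
        √(Fintype.card m : ℝ) + √(s : ℝ) + t < normMul v G} ≤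
      (Fintype.card q).choose s * Real.exp (-(t ^ 2 / 2)) := by
  set a := √(Fintype.card m : ℝ) + √(s : ℝ) + t with ha
  have ha0 : 0 < a := by positivity
  let K := {x : (m → ℝ) × (q → ℝ) // ∑ i, x.1 i ^ 2 = 1 ∧ x.2 ∈ sparseSphere q s}
  have hsub : {G : m × q → ℝ | ∃ v ∈ sparseSphere q s, a < normMul v G} ⊆
      {G | ∃ x : K, -bilin x.1.1 x.1.2 G < -a} := by
    rintro G ⟨v, hv, h⟩
    obtain ⟨u, hu, e⟩ := exists_bilin_eq_normMul (ha0.trans h)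
    exact ⟨⟨(u, v), hu, hv⟩, by simpa [e] using h⟩
  refine (measureReal_mono hsub (measure_ne_top _ _)).trans ?_
  refine measureReal_exists_lt_le_of_finite _ (fun x : K => fun G => -bilin x.1.1 x.1.2 G)
    (fun G => ?_) (by positivity) fun N d => ?_
  · exact (continuous_bilin.comp (continuous_subtype_val.prodMk continuous_const)).neg
  refine (measureReal_exists_lt_le (U := Unit) ht (fun i k => -(d i.2).1.1 k)
    (fun i => (d i).1.2) (fun i => by simpa using (d i.2).2.1) (fun i => (d i).2.2)
    (fun i G => -bilin (d i).1.1 (d i).1.2 G)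
    (fun i => (continuous_bilin.comp (continuous_const.prodMk continuous_id)).neg)
    (fun _ i G => by simp [bilin]) (fun g => -normOn Finset.univ g) (fun g i => ⟨(), ?_⟩) ?_
    (-a)).trans ?_
  · have := sum_mul_le_normOn (d i).2.1 (S := Finset.univ)
      (fun j hj => absurd (Finset.mem_univ j) hj) g
    simpa using this
  · simpa using integrable_exp_mul_normOn (Finset.univ : Finset m) ht
  · have h1 := integral_exp_mul_normOn_le (Finset.univ : Finset m) ht
    simp only [neg_mul_neg, Finset.card_univ] at h1 ⊢
    calc _ ≤ Real.exp (t * -a) * Real.exp (t * √(Fintype.card m : ℝ) + t ^ 2 / 2) *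
          ((Fintype.card q).choose s * Real.exp (t * √(s : ℝ))) := by gcongr
      _ = (Fintype.card q).choose s * (Real.exp (t * -a) *
          Real.exp (t * √(Fintype.card m : ℝ) + t ^ 2 / 2) * Real.exp (t * √(s : ℝ))) := by ring
      _ = _ := by
          rw [← Real.exp_add, ← Real.exp_add, ha]
          congr 2
          ring

/-- The unit sphere has finite subsets that realize the norm up to any factor below `1`. -/
theorem exists_finset_norming {m : Type*} [Fintype m] [Nonempty m] {ε : ℝ} (hε : 0 < ε) :
    ∃ D : Finset (m → ℝ), D.Nonempty ∧ (∀ u ∈ D, ∑ i, u i ^ 2 = 1) ∧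
      ∀ g : m → ℝ, ∃ u ∈ D, (1 - ε) * normOn Finset.univ g ≤ ∑ i, u i * g i := by
  classical
  let Sph : Set (m → ℝ) := {u | ∑ i, u i ^ 2 = 1}
  have hcl : IsClosed Sph := isClosed_eq (by fun_prop) continuous_const
  have hcomp : IsCompact Sph := by
    refine (isCompact_univ_pi fun _ : m =>
      isCompact_Icc (a := (-1 : ℝ)) (b := 1)).of_isClosed_subset hcl fun u hu i _ => ?_
    have h1 := Finset.single_le_sum (f := fun i => u i ^ 2) (fun _ _ => sq_nonneg _)
      (Finset.mem_univ i)
    have h2 : u i ^ 2 ≤ 1 := h1.trans_eq hu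
    exact abs_le.1 (abs_le_one_iff_mul_self_le_one.2 (by nlinarith))
  obtain ⟨T, hTs⟩ := hcomp.elim_nhds_subcover'
    (fun u _ => {u' | 1 - ε < ∑ i, u i * u' i}) (fun u hu => by
      refine (isOpen_lt continuous_const (by fun_prop)).mem_nhds ?_
      have : ∑ i, u i * u i = 1 := by
        have : ∑ i, u i ^ 2 = 1 := hu
        simpa only [sq] using this
      simp only [Set.mem_ofPred_eq, this]
      linarith)
  obtain ⟨i₀⟩ := ‹Nonempty m›
  let e : m → ℝ := Pi.single i₀ 1
  have he : ∑ i, e i ^ 2 = 1 := by simp [e, Pi.single_apply, ite_pow]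
  have hcov : ∀ g : m → ℝ, ∑ i, g i ^ 2 = 1 →
      ∃ u ∈ T.image Subtype.val, 1 - ε < ∑ i, u i * g i := by
    intro g hg
    obtain ⟨u, hu, h⟩ := Set.mem_iUnion₂.1 (hTs hg)
    exact ⟨u, Finset.mem_image_of_mem _ hu, h⟩
  have hne : (T.image Subtype.val).Nonempty := by
    obtain ⟨u, hu, _⟩ := hcov e he
    exact ⟨u, hu⟩
  refine ⟨T.image Subtype.val, hne, fun u hu => ?_, fun g => ?_⟩
  · obtain ⟨u', _, rfl⟩ := Finset.mem_image.1 hu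
    exact u'.2
  · rcases (normOn_nonneg Finset.univ g).eq_or_lt with h | h
    · obtain ⟨u, hu⟩ := hne
      refine ⟨u, hu, ?_⟩
      have h0 : ∑ k, g k ^ 2 = 0 := by rw [← sq_normOn, ← h]; ring
      have hz : ∀ k, g k = 0 := fun k => by
        have := (Finset.sum_eq_zero_iff_of_nonneg fun k _ => sq_nonneg (g k)).1 h0 k
          (Finset.mem_univ k)
        exact pow_eq_zero_iff two_ne_zero |>.1 this
      simp [← h, hz]
    · obtain ⟨u, hu, h'⟩ := hcov (fun i => g i / normOn Finset.univ g) (by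
        simp only [div_pow, ← Finset.sum_div]
        rw [← sq_normOn, div_self (by positivity)])
      refine ⟨u, hu, ?_⟩
      simp only [mul_div_assoc', ← Finset.sum_div] at h'
      rw [lt_div_iff₀ h] at h'
      exact h'.le

/-- Large deviations of the smallest `s`-sparse singular value of a Gaussian matrix. -/
theorem measureReal_normMul_lt_le {m q : Type*} [Fintype m] [Nonempty m] [Fintype q] (s : ℕ)
    {t : ℝ} (ht : 0 < t) :
    (stdGaussian (m × q)).real {G | ∃ v ∈ sparseSphere q s,
        normMul v G < √(Fintype.card m : ℝ) - √(s : ℝ) - t} ≤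
      (Fintype.card q).choose s * ((Fintype.card m + 2) * Real.exp t) *
        Real.exp (-(t ^ 2 / 2)) := by
  set r := √(Fintype.card m : ℝ) with hr
  set a := r - √(s : ℝ) - t with ha
  let B : ℝ → ℝ := fun l' => Real.exp (t * a) * ((Fintype.card m + 2) * Real.exp l' *
    Real.exp (-l' * r + l' ^ 2 / 2)) * ((Fintype.card q).choose s * Real.exp (t * √(s : ℝ)))
  have hB0 : ∀ l', 0 ≤ B l' := fun l' => by positivity
  -- the bound with a slack `ε` from the finite norming set
  have hε : ∀ ε ∈ Set.Ioo (0 : ℝ) 1, (stdGaussian (m × q)).real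
      {G | ∃ v ∈ sparseSphere q s, normMul v G < a} ≤ B (t * (1 - ε)) := by
    rintro ε ⟨h0, h1⟩
    obtain ⟨D, hD, hD1, hDn⟩ := exists_finset_norming (m := m) h0
    have : Nonempty D := hD.to_subtype
    have hset : {G : m × q → ℝ | ∃ v ∈ sparseSphere q s, normMul v G < a} =
        {G | ∃ v : sparseSphere q s, normMul v.1 G < a} := by
      ext G; simp
    rw [hset]
    refine measureReal_exists_lt_le_of_finite _
      (fun v : sparseSphere q s => fun G => normMul v.1 G) (fun G => ?_) (hB0 _)
      fun N d => ?_
    · exact (continuous_normMul_left G).comp continuous_subtype_val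
    have hl : 0 < t * (1 - ε) := mul_pos ht (by linarith)
    have hi := integrable_exp_neg_mul_normOn (Finset.univ : Finset m) hl.le
    have hle := integral_exp_neg_mul_normOn_le (Finset.univ : Finset m) hl
    have e : ∀ g : m → ℝ, -(t * (1 - ε)) * normOn Finset.univ g =
        -t * ((1 - ε) * normOn Finset.univ g) := fun g => by ring
    simp only [e] at hi hle
    rw [Finset.card_univ, ← hr] at hle
    clear_value r
    refine (measureReal_exists_lt_le (U := D) ht (fun i => i.1.1) (fun i => (d i).1)
      (fun i => hD1 _ i.1.2) (fun i => (d i).2) (fun i G => normMul (d i).1 G)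
      (fun i => continuous_normMul_right _)
      (fun u i G => bilin_le_normMul (hD1 _ u.2) _ G) (fun g => (1 - ε) * normOn Finset.univ g)
      (fun g i => ?_) hi a).trans ?_
    · obtain ⟨u, hu, h⟩ := hDn g
      exact ⟨⟨u, hu⟩, h⟩
    · exact mul_le_mul_of_nonneg_right (mul_le_mul_of_nonneg_left hle (Real.exp_pos _).le)
        (by positivity)
  have hlim : Tendsto (fun ε : ℝ => B (t * (1 - ε))) (𝓝[>] 0) (𝓝 (B t)) := by
    have : Continuous fun ε : ℝ => B (t * (1 - ε)) := by fun_prop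
    have h := this.tendsto 0
    rw [sub_zero, mul_one] at h
    exact h.mono_left nhdsWithin_le_nhds
  have := ge_of_tendsto hlim (by
    filter_upwards [Ioo_mem_nhdsGT (zero_lt_one' ℝ)] with ε h using hε ε h)
  refine this.trans_eq ?_
  simp only [B]
  have e : Real.exp (t * a) * Real.exp (-t * r + t ^ 2 / 2) * Real.exp (t * √(s : ℝ)) =
      Real.exp (-(t ^ 2 / 2)) := by
    rw [← Real.exp_add, ← Real.exp_add, ha]
    congr 1; ring
  rw [← e]
  ring

/-! ### Euclidean and `ℓ₁` norms in coordinates -/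

theorem sq_l2 {m : ℕ} (v : Fin m → ℝ) : l2 v ^ 2 = ∑ i, v i ^ 2 := by
  have := EuclideanSpace.real_norm_sq_eq (WithLp.toLp 2 v : EuclideanSpace ℝ (Fin m))
  simpa [l2] using this

theorem l2_nonneg {m : ℕ} (v : Fin m → ℝ) : 0 ≤ l2 v := norm_nonneg _

theorem l2_eq_normOn {m : ℕ} (v : Fin m → ℝ) : l2 v = normOn Finset.univ v := by
  rw [normOn, ← sq_l2, Real.sqrt_sq (l2_nonneg v)]

theorem l1_eq {m : ℕ} (v : Fin m → ℝ) : l1 v = ∑ i, |v i| := by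
  simp [l1, PiLp.norm_eq_of_L1]

theorem l2_sub_le {m : ℕ} (v w : Fin m → ℝ) : l2 (v - w) ≤ l2 v + l2 w := by
  unfold l2
  rw [WithLp.toLp_sub]
  exact norm_sub_le _ _

/-! ### Restricted isometry constants -/

theorem cMin_nonneg {n p : ℕ} (s : ℕ) (M : Matrix (Fin n) (Fin p) ℝ) : 0 ≤ cMin s M :=
  Real.sInf_nonneg fun _ hc => hc.1

theorem cMax_nonneg {n p : ℕ} (s : ℕ) (M : Matrix (Fin n) (Fin p) ℝ) : 0 ≤ cMax s M :=
  Real.sInf_nonneg fun _ hc => hc.1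

theorem cMin_set_nonempty {n p : ℕ} (s : ℕ) (M : Matrix (Fin n) (Fin p) ℝ) :
    {c | 0 ≤ c ∧ ∀ x ∈ sparse p s, (1 - c) * l2 x ^ 2 ≤ l2 (M.mulVec x) ^ 2}.Nonempty :=
  ⟨1, zero_le_one, fun x _ => by rw [sub_self, zero_mul]; positivity⟩

theorem cMax_set_nonempty {n p : ℕ} (s : ℕ) (M : Matrix (Fin n) (Fin p) ℝ) :
    {c | 0 ≤ c ∧ ∀ x ∈ sparse p s, l2 (M.mulVec x) ^ 2 ≤ (1 + c) * l2 x ^ 2}.Nonempty := by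
  refine ⟨∑ i, ∑ j, M i j ^ 2,
    Finset.sum_nonneg fun i _ => Finset.sum_nonneg fun j _ => sq_nonneg _,
    fun x _ => ?_⟩
  have : l2 (M.mulVec x) ^ 2 ≤ (∑ i, ∑ j, M i j ^ 2) * l2 x ^ 2 := by
    rw [sq_l2, sq_l2, Finset.sum_mul]
    exact Finset.sum_le_sum fun i _ => Finset.sum_mul_sq_le_sq_mul_sq Finset.univ (M i) x
  nlinarith [sq_nonneg (l2 x)]

theorem bddBelow_of_nonneg {P : ℝ → Prop} : BddBelow {c : ℝ | 0 ≤ c ∧ P c} := ⟨0, fun _ h => h.1⟩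

theorem cMin_spec {n p : ℕ} {s : ℕ} (M : Matrix (Fin n) (Fin p) ℝ) {x : Fin p → ℝ}
    (hx : x ∈ sparse p s) : (1 - cMin s M) * l2 x ^ 2 ≤ l2 (M.mulVec x) ^ 2 := by
  have hcl : IsClosed {c | 0 ≤ c ∧ ∀ x ∈ sparse p s, (1 - c) * l2 x ^ 2 ≤ l2 (M.mulVec x) ^ 2} := by
    simp only [Set.ofPred_and, Set.ofPred_forall]
    exact isClosed_Ici.inter (isClosed_iInter fun x => isClosed_iInter fun _ =>
      isClosed_le (by fun_prop) continuous_const)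
  exact (hcl.csInf_mem (cMin_set_nonempty s M) bddBelow_of_nonneg).2 x hx

theorem cMax_spec {n p : ℕ} {s : ℕ} (M : Matrix (Fin n) (Fin p) ℝ) {x : Fin p → ℝ}
    (hx : x ∈ sparse p s) : l2 (M.mulVec x) ^ 2 ≤ (1 + cMax s M) * l2 x ^ 2 := by
  have hcl : IsClosed {c | 0 ≤ c ∧ ∀ x ∈ sparse p s, l2 (M.mulVec x) ^ 2 ≤ (1 + c) * l2 x ^ 2} := by
    simp only [Set.ofPred_and, Set.ofPred_forall]
    exact isClosed_Ici.inter (isClosed_iInter fun x => isClosed_iInter fun _ =>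
      isClosed_le continuous_const (by fun_prop))
  exact (hcl.csInf_mem (cMax_set_nonempty s M) bddBelow_of_nonneg).2 x hx

theorem exists_of_lt_cMin {n p : ℕ} {s : ℕ} (M : Matrix (Fin n) (Fin p) ℝ) {c : ℝ} (h0 : 0 ≤ c)
    (h : c < cMin s M) : ∃ x ∈ sparse p s, l2 (M.mulVec x) ^ 2 < (1 - c) * l2 x ^ 2 := by
  by_contra! hx
  exact h.not_ge (csInf_le bddBelow_of_nonneg ⟨h0, hx⟩)

theorem exists_of_lt_cMax {n p : ℕ} {s : ℕ} (M : Matrix (Fin n) (Fin p) ℝ) {c : ℝ} (h0 : 0 ≤ c)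
    (h : c < cMax s M) : ∃ x ∈ sparse p s, (1 + c) * l2 x ^ 2 < l2 (M.mulVec x) ^ 2 := by
  by_contra! hx
  exact h.not_ge (csInf_le bddBelow_of_nonneg ⟨h0, hx⟩)

theorem sparse_mono {p s t : ℕ} (h : s ≤ t) : sparse p s ⊆ sparse p t := fun _ hx =>
  le_trans (show _ ≤ s from hx) h

theorem cMin_mono {n p s t : ℕ} (M : Matrix (Fin n) (Fin p) ℝ) (h : s ≤ t) :
    cMin s M ≤ cMin t M :=
  csInf_le_csInf bddBelow_of_nonneg (cMin_set_nonempty t M) fun _ hc =>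
    ⟨hc.1, fun x hx => hc.2 x (sparse_mono h hx)⟩

theorem cMax_mono {n p s t : ℕ} (M : Matrix (Fin n) (Fin p) ℝ) (h : s ≤ t) :
    cMax s M ≤ cMax t M :=
  csInf_le_csInf bddBelow_of_nonneg (cMax_set_nonempty t M) fun _ hc =>
    ⟨hc.1, fun x hx => hc.2 x (sparse_mono h hx)⟩

/-! ### Restrictions and block decompositions -/

/-- The vector `v` with the coordinates outside `S` replaced by zero. -/
def restr {p : ℕ} (S : Finset (Fin p)) (v : Fin p → ℝ) : Fin p → ℝ := fun i =>
  if i ∈ S then v i else 0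

theorem sq_l2_restr {p : ℕ} (S : Finset (Fin p)) (v : Fin p → ℝ) :
    l2 (restr S v) ^ 2 = normOn S v ^ 2 := by
  rw [sq_l2, sq_normOn]
  simp [restr, ite_pow, Finset.sum_ite_mem]

theorem restr_union {p : ℕ} {S T : Finset (Fin p)} (h : Disjoint S T) (v : Fin p → ℝ) :
    restr (S ∪ T) v = restr S v + restr T v := by
  funext i
  by_cases hS : i ∈ S
  · simp [restr, hS, Finset.disjoint_left.1 h hS]
  · simp [restr, hS]

theorem mem_sparse_of_support {p s : ℕ} {x : Fin p → ℝ} (S : Finset (Fin p)) (hS : S.card ≤ s)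
    (h : ∀ i ∉ S, x i = 0) : x ∈ sparse p s := by
  have h1 : {i | x i ≠ 0} ⊆ (S : Set (Fin p)) := fun i hi => by
    by_contra hiS
    exact hi (h i hiS)
  refine le_trans (Set.ncard_le_ncard h1 S.finite_toSet) ?_
  rwa [Set.ncard_coe_finset]

/-- The `s` largest values of `f` on `T`, separated from the other values by a threshold `c`. -/
theorem exists_top_subset {α : Type*} [DecidableEq α] (f : α → ℝ) (T : Finset α) {s : ℕ}
    (hs : 1 ≤ s) (hT : s ≤ T.card) :
    ∃ S ⊆ T, S.card = s ∧ ∃ c, (∃ i ∈ S, f i = c) ∧ (∀ i ∈ S, c ≤ f i) ∧ ∀ j ∈ T \ S, f j ≤ c := by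
  induction s, hs using Nat.le_induction with
  | base =>
    obtain ⟨a, ha, hmax⟩ := T.exists_max_image f (Finset.card_pos.1 hT)
    exact ⟨{a}, by simpa using ha, by simp, f a, ⟨a, by simp, rfl⟩, by simp,
      fun j hj => hmax j (Finset.mem_sdiff.1 hj).1⟩
  | succ s hs ih =>
    obtain ⟨S, hST, hc, c, _, h1, h2⟩ := ih (by omega)
    have hne : (T \ S).Nonempty := by
      rw [← Finset.card_pos, Finset.card_sdiff_of_subset hST]; omega
    obtain ⟨a, ha, hmax⟩ := (T \ S).exists_max_image f hne
    have ha' := Finset.mem_sdiff.1 ha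
    refine ⟨insert a S, Finset.insert_subset ha'.1 hST, by
      rw [Finset.card_insert_of_notMem ha'.2, hc], f a, ⟨a, by simp, rfl⟩, fun i hi => ?_,
      fun j hj => hmax j ?_⟩
    · rcases Finset.mem_insert.1 hi with rfl | hi
      · exact le_rfl
      · exact (h2 a ha).trans (h1 i hi)
    · simp only [Finset.mem_sdiff, Finset.mem_insert, not_or] at hj ⊢
      exact ⟨hj.1, hj.2.2⟩

theorem normOn_le_of_sum_sq_le {p : ℕ} {S : Finset (Fin p)} {v : Fin p → ℝ} {r : ℝ} (hr : 0 ≤ r)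
    (h : ∑ i ∈ S, v i ^ 2 ≤ r ^ 2) : normOn S v ≤ r :=
  Real.sqrt_le_iff.2 ⟨hr, h⟩

/-- The square root lifting inequality, comparing the `ℓ₂`-norm of a block with its `ℓ₁`-norm and
the range `[c, μ]` of its entries. -/
theorem normOn_le_of_mem_Icc {p : ℕ} {S : Finset (Fin p)} {v : Fin p → ℝ} {s : ℕ} (hs : 1 ≤ s)
    (hS : S.card = s) {c μ : ℝ} (hc : 0 ≤ c) (hcμ : c ≤ μ) (h : ∀ i ∈ S, c ≤ |v i| ∧ |v i| ≤ μ) :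
    normOn S v ≤ (∑ i ∈ S, |v i|) / √(s : ℝ) + √(s : ℝ) * (μ - c) / 4 := by
  have hs0 : (0 : ℝ) < s := by exact_mod_cast hs
  obtain ⟨r, hr⟩ : ∃ r, r = √(s : ℝ) := ⟨_, rfl⟩
  have hr0 : 0 < r := hr ▸ Real.sqrt_pos.2 hs0
  have hr2 : (s : ℝ) = r ^ 2 := by rw [hr, Real.sq_sqrt hs0.le]
  rw [← hr]
  obtain ⟨A, hA⟩ : ∃ A, A = ∑ i ∈ S, |v i| := ⟨_, rfl⟩
  have hA0 : 0 ≤ A := hA ▸ Finset.sum_nonneg fun _ _ => abs_nonneg _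
  rw [← hA]
  have h1 : ∑ i ∈ S, v i ^ 2 ≤ (μ + c) * A - r ^ 2 * (c * μ) := by
    have : ∑ i ∈ S, v i ^ 2 ≤ ∑ i ∈ S, ((μ + c) * |v i| - c * μ) := by
      refine Finset.sum_le_sum fun i hi => ?_
      obtain ⟨h1, h2⟩ := h i hi
      rw [← sq_abs]
      nlinarith
    rw [Finset.sum_sub_distrib, ← Finset.mul_sum, ← hA, Finset.sum_const, hS, nsmul_eq_mul,
      hr2] at this
    exact this
  refine normOn_le_of_sum_sq_le (by have := sub_nonneg.2 hcμ; positivity) (h1.trans ?_)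
  obtain ⟨y, hy⟩ : ∃ y, y = A / r := ⟨_, rfl⟩
  have hAy : A = y * r := by rw [hy]; field_simp
  rw [← hy, hAy]
  nlinarith [sq_nonneg (y - r * (μ + 3 * c) / 4), mul_nonneg (sq_nonneg r)
    (mul_nonneg hc (sub_nonneg.2 hcμ))]

theorem normOn_le_of_card_le {p : ℕ} {S : Finset (Fin p)} {v : Fin p → ℝ} {s : ℕ} (hs : 1 ≤ s)
    {μ : ℝ} (hμ : 0 ≤ μ) (h : ∀ i ∈ S, |v i| ≤ μ) :
    normOn S v ≤ (∑ i ∈ S, |v i|) / √(s : ℝ) + √(s : ℝ) * μ / 4 := by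
  have hs0 : (0 : ℝ) < s := by exact_mod_cast hs
  obtain ⟨r, hr⟩ : ∃ r, r = √(s : ℝ) := ⟨_, rfl⟩
  have hr0 : 0 < r := hr ▸ Real.sqrt_pos.2 hs0
  rw [← hr]
  obtain ⟨A, hA⟩ : ∃ A, A = ∑ i ∈ S, |v i| := ⟨_, rfl⟩
  have hA0 : 0 ≤ A := hA ▸ Finset.sum_nonneg fun _ _ => abs_nonneg _
  rw [← hA]
  have h1 : ∑ i ∈ S, v i ^ 2 ≤ μ * A := by
    rw [hA, Finset.mul_sum]
    refine Finset.sum_le_sum fun i hi => ?_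
    rw [← sq_abs]
    nlinarith [h i hi, abs_nonneg (v i)]
  refine normOn_le_of_sum_sq_le (by positivity) (h1.trans ?_)
  obtain ⟨y, hy⟩ : ∃ y, y = A / r := ⟨_, rfl⟩
  have hAy : A = y * r := by rw [hy]; field_simp
  rw [← hy, hAy]
  nlinarith [sq_nonneg (y - r * μ / 4)]

/-- A linear functional that is bounded by the `ℓ₂`-norm on blocks of size `s` is bounded on all of
`T` by the `ℓ₁`-norm and the maximal entry: cut `T` into blocks in decreasing order, and apply the
square root lifting inequality to each. -/
theorem abs_apply_restr_le {p : ℕ} (Φ : (Fin p → ℝ) →ₗ[ℝ] ℝ) (v : Fin p → ℝ) {s : ℕ} (hs : 1 ≤ s)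
    {K : ℝ} (hK : 0 ≤ K) (T : Finset (Fin p))
    (hΦ : ∀ S ⊆ T, S.card ≤ s → |Φ (restr S v)| ≤ K * normOn S v) {μ : ℝ} (hμ : 0 ≤ μ)
    (h : ∀ i ∈ T, |v i| ≤ μ) :
    |Φ (restr T v)| ≤ K * ((∑ i ∈ T, |v i|) / √(s : ℝ) + √(s : ℝ) * μ / 4) := by
  induction T using Finset.strongInduction generalizing μ with
  | H T ih =>
    rcases le_or_gt T.card s with hT | hT
    · exact (hΦ T subset_rfl hT).trans
        (mul_le_mul_of_nonneg_left (normOn_le_of_card_le hs hμ h) hK)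
    · obtain ⟨S, hST, hSc, c, ⟨i₀, hi₀, hc₀⟩, h1, h2⟩ :=
        exists_top_subset (fun i => |v i|) T hs hT.le
      have hc : 0 ≤ c := hc₀ ▸ abs_nonneg _
      have hcμ : c ≤ μ := hc₀ ▸ h i₀ (hST hi₀)
      have hlt : T \ S ⊂ T := Finset.sdiff_ssubset hST ⟨i₀, hi₀⟩
      have a1 := ih (T \ S) hlt (fun S' hS' => hΦ S' (hS'.trans hlt.subset)) hc h2
      have a2 := (hΦ S hST hSc.le).trans (mul_le_mul_of_nonneg_left (normOn_le_of_mem_Icc hs hSc hc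
        hcμ fun i hi => ⟨h1 i hi, h i (hST hi)⟩) hK)
      have e : restr T v = restr S v + restr (T \ S) v := by
        rw [← restr_union Finset.disjoint_sdiff, Finset.union_sdiff_of_subset hST]
      have e2 : ∑ i ∈ T, |v i| = ∑ i ∈ S, |v i| + ∑ i ∈ T \ S, |v i| := by
        rw [add_comm, Finset.sum_sdiff hST]
      rw [e, map_add, e2, add_div]
      refine (abs_add_le _ _).trans ((add_le_add a2 a1).trans_eq ?_)
      ring

/-! ### The robust null space property -/

theorem sq_le_of_forall_quadratic_nonneg {a b c : ℝ}
    (h : ∀ x : ℝ, 0 ≤ a * (x * x) + 2 * b * x + c) :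
    b ^ 2 ≤ a * c := by
  have := discrim_le_zero h
  unfold discrim at this
  linarith

/-- Two vectors with disjoint supports stay almost orthogonal under `M`. The bound is relative to
`‖M u‖²`, a factor that cancels in the null space estimate. The hypothesis on `κ` says that
`κ = (L - m) / (2 √(L m))` up to sign. -/
theorem sq_dotProduct_mulVec_le {n p : ℕ} (M : Matrix (Fin n) (Fin p) ℝ) {m L κ : ℝ} (hm : 0 < m)
    (hL : 0 < L) (hκ : 4 * L * m * κ ^ 2 = (L - m) ^ 2) (u w : Fin p → ℝ)
    (huw : ∀ i, u i * w i = 0)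
    (hlow : ∀ x : ℝ, m * l2 (x • u + w) ^ 2 ≤ l2 (M.mulVec (x • u + w)) ^ 2)
    (hupp : ∀ x : ℝ, l2 (M.mulVec (x • u + w)) ^ 2 ≤ L * l2 (x • u + w) ^ 2) :
    (∑ i, M.mulVec u i * M.mulVec w i) ^ 2 * l2 u ^ 2 ≤
      κ ^ 2 * (l2 (M.mulVec u) ^ 2) ^ 2 * l2 w ^ 2 := by
  have e1 : ∀ x : ℝ, l2 (x • u + w) ^ 2 = x * x * l2 u ^ 2 + l2 w ^ 2 := fun x => by
    simp only [sq_l2, Finset.mul_sum, ← Finset.sum_add_distrib]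
    refine Finset.sum_congr rfl fun i _ => ?_
    simp only [Pi.add_apply, Pi.smul_apply, smul_eq_mul]
    linear_combination 2 * x * huw i
  have e2 : ∀ x : ℝ, l2 (M.mulVec (x • u + w)) ^ 2 = x * x * l2 (M.mulVec u) ^ 2 +
      2 * x * (∑ i, M.mulVec u i * M.mulVec w i) + l2 (M.mulVec w) ^ 2 := fun x => by
    rw [Matrix.mulVec_add, Matrix.mulVec_smul]
    simp only [sq_l2, Finset.mul_sum, ← Finset.sum_add_distrib]
    refine Finset.sum_congr rfl fun i _ => ?_
    simp only [Pi.add_apply, Pi.smul_apply, smul_eq_mul]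
    ring
  simp only [e1, e2] at hlow hupp
  obtain ⟨c, hc⟩ : ∃ c, c = ∑ i, M.mulVec u i * M.mulVec w i := ⟨_, rfl⟩
  obtain ⟨Q, hQ⟩ : ∃ Q, Q = l2 (M.mulVec u) ^ 2 := ⟨_, rfl⟩
  obtain ⟨R, hR⟩ : ∃ R, R = l2 (M.mulVec w) ^ 2 := ⟨_, rfl⟩
  obtain ⟨U, hU⟩ : ∃ U, U = l2 u ^ 2 := ⟨_, rfl⟩
  obtain ⟨W, hW⟩ : ∃ W, W = l2 w ^ 2 := ⟨_, rfl⟩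
  have hU0 : 0 ≤ U := hU ▸ sq_nonneg _
  have hW0 : 0 ≤ W := hW ▸ sq_nonneg _
  rw [← hc, ← hQ, ← hU, ← hW]
  simp only [← hc, ← hQ, ← hR, ← hU, ← hW] at hlow hupp
  have d1 : c ^ 2 ≤ (Q - m * U) * (R - m * W) :=
    sq_le_of_forall_quadratic_nonneg fun x => by nlinarith [hlow x]
  have d2 : (-c) ^ 2 ≤ (L * U - Q) * (L * W - R) :=
    sq_le_of_forall_quadratic_nonneg fun x => by nlinarith [hupp x]
  have p1 : 0 ≤ Q - m * U := by
    by_contra! hneg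
    -- a quadratic polynomial with negative leading coefficient is not bounded below
    have h1 : ∀ x : ℝ, 0 ≤ (Q - m * U) * (x * x) + 2 * c * x + (R - m * W) := fun x => by
      nlinarith [hlow x]
    have h2 := h1 0
    have h3 : R - m * W = 0 := by nlinarith [sq_nonneg c]
    have h4 : c = 0 := by
      have : c ^ 2 ≤ 0 := by rw [h3] at d1; simpa using d1
      exact pow_eq_zero_iff two_ne_zero |>.1 (le_antisymm this (sq_nonneg c))
    have := h1 1
    rw [h3, h4] at this
    linarith
  have p2 : 0 ≤ L * U - Q := by
    by_contra! hneg
    have h1 : ∀ x : ℝ, 0 ≤ (L * U - Q) * (x * x) + 2 * (-c) * x + (L * W - R) := fun x => by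
      nlinarith [hupp x]
    have h2 := h1 0
    have h3 : L * W - R = 0 := by nlinarith [sq_nonneg c]
    have h4 : c = 0 := by
      have : (-c) ^ 2 ≤ 0 := by rw [h3] at d2; simpa using d2
      have : c ^ 2 ≤ 0 := by simpa using this
      exact pow_eq_zero_iff two_ne_zero |>.1 (le_antisymm this (sq_nonneg c))
    have := h1 1
    rw [h3, h4] at this
    linarith
  have key : c ^ 2 * U ≤ (L * U - Q) * (Q - m * U) * W := by
    rcases le_total ((R - m * W) * U) ((L * U - Q) * W) with h | h
    · calc c ^ 2 * U ≤ (Q - m * U) * (R - m * W) * U := mul_le_mul_of_nonneg_right d1 hU0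
        _ = (Q - m * U) * ((R - m * W) * U) := by ring
        _ ≤ (Q - m * U) * ((L * U - Q) * W) := mul_le_mul_of_nonneg_left h p1
        _ = _ := by ring
    · have h' : (L * W - R) * U ≤ (Q - m * U) * W := by nlinarith
      calc c ^ 2 * U = (-c) ^ 2 * U := by ring
        _ ≤ (L * U - Q) * (L * W - R) * U := mul_le_mul_of_nonneg_right d2 hU0
        _ = (L * U - Q) * ((L * W - R) * U) := by ring
        _ ≤ (L * U - Q) * ((Q - m * U) * W) := mul_le_mul_of_nonneg_left h' p2
        _ = _ := by ring
  have h4 : 4 * L * m * ((L * U - Q) * (Q - m * U)) ≤ 4 * L * m * (κ ^ 2 * Q ^ 2) := by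
    have : 4 * L * m * (κ ^ 2 * Q ^ 2) = (L - m) ^ 2 * Q ^ 2 := by rw [← hκ]; ring
    rw [this]
    nlinarith [sq_nonneg ((L + m) * Q - 2 * L * m * U)]
  have h5 := le_of_mul_le_mul_left h4 (by positivity : 0 < 4 * L * m)
  exact key.trans (mul_le_mul_of_nonneg_right h5 hW0)

/-- The `ℓ₂`-robust null space property for a set `S₀` that carries the largest entries of `v`. -/
theorem normOn_le_of_restricted_isometry {n p : ℕ} (M : Matrix (Fin n) (Fin p) ℝ) {s : ℕ}
    (hs : 1 ≤ s) {m L κ : ℝ} (hm : 0 < m) (hL : 0 < L) (hκ0 : 0 ≤ κ)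
    (hκ : 4 * L * m * κ ^ 2 = (L - m) ^ 2)
    (hlow : ∀ x ∈ sparse p (2 * s), m * l2 x ^ 2 ≤ l2 (M.mulVec x) ^ 2)
    (hupp : ∀ x ∈ sparse p (2 * s), l2 (M.mulVec x) ^ 2 ≤ L * l2 x ^ 2) (v : Fin p → ℝ)
    (S₀ : Finset (Fin p)) (hS₀ : S₀.card ≤ s)
    (htop : ∀ j ∉ S₀, |v j| ≤ normOn S₀ v / √(s : ℝ)) :
    normOn S₀ v * (1 - κ / 4) ≤
      κ * ((∑ i ∈ S₀ᶜ, |v i|) / √(s : ℝ)) + l2 (M.mulVec v) / √m := by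
  have hsr : 0 < √(s : ℝ) := Real.sqrt_pos.2 (by exact_mod_cast hs)
  have hmr : 0 < √m := Real.sqrt_pos.2 hm
  have hσ : 0 ≤ ∑ i ∈ S₀ᶜ, |v i| := Finset.sum_nonneg fun _ _ => abs_nonneg _
  obtain ⟨A, hA⟩ : ∃ A, A = normOn S₀ v := ⟨_, rfl⟩
  rcases (normOn_nonneg S₀ v).eq_or_lt with h0 | hpos
  · rw [← h0, zero_mul]
    have := l2_nonneg (M.mulVec v)
    positivity
  rw [← hA] at hpos htop ⊢
  set u := restr S₀ v with hu
  have hu2 : l2 u ^ 2 = A ^ 2 := by rw [hu, sq_l2_restr, hA]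
  have hsp : ∀ {S T : Finset (Fin p)}, S.card ≤ s → T.card ≤ s → ∀ x y : ℝ,
      x • restr S v + y • restr T v ∈ sparse p (2 * s) := fun {S T} hS hT x y => by
    refine mem_sparse_of_support (S ∪ T) ((Finset.card_union_le _ _).trans (by omega))
      fun i hi => ?_
    rw [Finset.mem_union, not_or] at hi
    simp [restr, hi.1, hi.2]
  obtain ⟨q, hq⟩ : ∃ q, q = l2 (M.mulVec u) := ⟨_, rfl⟩
  have hq0 : 0 ≤ q := hq ▸ l2_nonneg _
  have hqA : m * A ^ 2 ≤ q ^ 2 := by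
    have := hlow u (by simpa using hsp hS₀ hS₀ 1 0)
    rwa [hu2, ← hq] at this
  have hqpos : 0 < q := by
    have : 0 < m * A ^ 2 := by positivity
    exact lt_of_le_of_ne hq0 fun h => by rw [← h] at hqA; nlinarith
  let Φ : (Fin p → ℝ) →ₗ[ℝ] ℝ := (dotProductBilin ℝ ℝ (M.mulVec u)).comp M.mulVecLin
  have hΦ : ∀ x, Φ x = ∑ i, M.mulVec u i * M.mulVec x i := fun x => by
    simp [Φ, dotProduct]
  have hblock : ∀ S ⊆ S₀ᶜ, S.card ≤ s → |Φ (restr S v)| ≤ κ * q ^ 2 / A * normOn S v := by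
    intro S hS hSc
    have hdisj : ∀ i, u i * restr S v i = 0 := fun i => by
      by_cases hi : i ∈ S
      · have := Finset.mem_compl.1 (hS hi)
        simp [hu, restr, this]
      · simp [restr, hi]
    have := sq_dotProduct_mulVec_le M hm hL hκ u (restr S v) hdisj
      (fun x => hlow _ (by simpa using hsp hS₀ hSc x 1))
      (fun x => hupp _ (by simpa using hsp hS₀ hSc x 1))
    rw [← hΦ, ← hq, hu2, sq_l2_restr] at this
    have hN := normOn_nonneg S v
    refine abs_le_of_sq_le_sq ?_ (by positivity)
    have e : (κ * q ^ 2 / A * normOn S v) ^ 2 = κ ^ 2 * (q ^ 2) ^ 2 * normOn S v ^ 2 / A ^ 2 := by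
      field_simp
    rw [e, le_div_iff₀ (by positivity)]
    exact this
  have htail := abs_apply_restr_le Φ v hs (K := κ * q ^ 2 / A) (by positivity) S₀ᶜ hblock
    (μ := A / √(s : ℝ)) (by positivity) fun i hi => htop i (Finset.mem_compl.1 hi)
  have hsplit : v = u + restr S₀ᶜ v := by
    rw [hu, ← restr_union disjoint_compl_right, Finset.union_compl]
    funext i; simp [restr]
  have hΦu : Φ u = q ^ 2 := by
    rw [hΦ, hq, sq_l2]; exact Finset.sum_congr rfl fun i _ => (sq _).symm
  have hΦv : Φ v ≤ q * l2 (M.mulVec v) := by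
    rw [hΦ, hq, l2_eq_normOn, l2_eq_normOn]
    exact Real.sum_mul_le_sqrt_mul_sqrt _ _ _
  have hΦs : Φ v = q ^ 2 + Φ (restr S₀ᶜ v) := by
    conv_lhs => rw [hsplit]
    rw [map_add, hΦu]
  have e4 : √(s : ℝ) * (A / √(s : ℝ)) / 4 = A / 4 := by field_simp
  rw [e4] at htail
  obtain ⟨y, hy⟩ : ∃ y, y = (∑ i ∈ S₀ᶜ, |v i|) / √(s : ℝ) := ⟨_, rfl⟩
  rw [← hy] at htail ⊢
  obtain ⟨E, hE⟩ : ∃ E, E = l2 (M.mulVec v) := ⟨_, rfl⟩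
  have hE0 : 0 ≤ E := hE ▸ l2_nonneg _
  rw [← hE] at hΦv ⊢
  have h1 : q ^ 2 ≤ q * E + κ * q ^ 2 / A * (y + A / 4) := by
    have := (abs_le.1 htail).1
    linarith
  -- division by `q ^ 2 / A`
  have h2 : A ≤ A / q * E + κ * (y + A / 4) := by
    have h3 := mul_le_mul_of_nonneg_left h1 (by positivity : 0 ≤ A / q ^ 2)
    have e5 : A / q ^ 2 * q ^ 2 = A := by field_simp
    have e6 : A / q ^ 2 * (q * E + κ * q ^ 2 / A * (y + A / 4)) =
        A / q * E + κ * (y + A / 4) := by field_simp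
    rwa [e5, e6] at h3
  have h3 : A / q ≤ 1 / √m := by
    rw [div_le_div_iff₀ hqpos hmr, one_mul]
    refine abs_le_of_sq_le_sq' ?_ hq0 |>.2
    rw [mul_pow, Real.sq_sqrt hm.le]
    linarith
  have h4 : A / q * E ≤ E / √m := by
    have := mul_le_mul_of_nonneg_right h3 hE0
    rwa [one_div_mul_eq_div] at this
  linarith

/-! ### Sparse recovery from restricted isometry -/

theorem exists_top_set {p : ℕ} (h : Fin p → ℝ) {s : ℕ} (hs : 1 ≤ s) :
    ∃ S₀ : Finset (Fin p), S₀.card ≤ s ∧ (∀ j ∉ S₀, |h j| ≤ normOn S₀ h / √(s : ℝ)) ∧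
      ∀ S : Finset (Fin p), S.card ≤ s → ∑ i ∈ S, |h i| ≤ ∑ i ∈ S₀, |h i| := by
  have hs0 : (0 : ℝ) < s := by exact_mod_cast hs
  rcases le_or_gt p s with hp | hp
  · exact ⟨Finset.univ, by simpa using hp, fun j hj => absurd (Finset.mem_univ j) hj, fun S _ =>
      Finset.sum_le_sum_of_subset_of_nonneg (Finset.subset_univ S) fun _ _ _ => abs_nonneg _⟩
  · obtain ⟨S₀, -, hc, c, ⟨i₀, hi₀, hci⟩, h1, h2⟩ := exists_top_subset (fun i => |h i|)
      Finset.univ hs (by simpa using hp.le)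
    have hc0 : 0 ≤ c := hci ▸ abs_nonneg _
    have h2' : ∀ j ∉ S₀, |h j| ≤ c := fun j hj => h2 j (by simpa using hj)
    refine ⟨S₀, hc.le, fun j hj => (h2' j hj).trans ?_, fun S hS => ?_⟩
    · rw [le_div_iff₀ (Real.sqrt_pos.2 hs0)]
      refine abs_le_of_sq_le_sq' ?_ (normOn_nonneg _ _) |>.2
      rw [mul_pow, Real.sq_sqrt hs0.le, sq_normOn]
      have := Finset.card_nsmul_le_sum S₀ (fun i => h i ^ 2) (c ^ 2) fun i hi => by
        rw [← sq_abs (h i)]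
        exact pow_le_pow_left₀ hc0 (h1 i hi) 2
      rw [hc, nsmul_eq_mul] at this
      linarith
    · have a1 : ∑ i ∈ S, (|h i| - c) ≤ ∑ i ∈ S ∩ S₀, (|h i| - c) := by
        rw [← Finset.sum_inter_add_sum_sdiff S S₀]
        have : ∑ i ∈ S \ S₀, (|h i| - c) ≤ 0 := Finset.sum_nonpos fun i hi => by
          have := h2' i (Finset.mem_sdiff.1 hi).2
          linarith
        linarith
      have a2 : ∑ i ∈ S ∩ S₀, (|h i| - c) ≤ ∑ i ∈ S₀, (|h i| - c) :=
        Finset.sum_le_sum_of_subset_of_nonneg Finset.inter_subset_right fun i hi _ => by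
          have := h1 i hi
          linarith
      have a3 := a1.trans a2
      simp only [Finset.sum_sub_distrib, Finset.sum_const, nsmul_eq_mul, hc] at a3
      have : (S.card : ℝ) ≤ s := by exact_mod_cast hS
      nlinarith

/-- Restricted isometry with `κ < 4 / 5` implies stable and robust sparse recovery. -/
theorem srsr_of_restricted_isometry {n p : ℕ} (M : Matrix (Fin n) (Fin p) ℝ) {s : ℕ}
    (hs : 1 ≤ s) {m L κ : ℝ} (hm : 0 < m) (hL : 0 < L) (hκ0 : 0 ≤ κ) (hκ1 : κ < 4 / 5)
    (hκ : 4 * L * m * κ ^ 2 = (L - m) ^ 2)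
    (hlow : ∀ x ∈ sparse p (2 * s), m * l2 x ^ 2 ≤ l2 (M.mulVec x) ^ 2)
    (hupp : ∀ x ∈ sparse p (2 * s), l2 (M.mulVec x) ^ 2 ≤ L * l2 x ^ 2) :
    SRSR M s (6 / (1 - 5 * κ / 4)) (4 / (√m * (1 - 5 * κ / 4))) := by
  intro x₀ e η he x hx
  obtain ⟨r, hr⟩ : ∃ r, r = √(s : ℝ) := ⟨_, rfl⟩
  have hr0 : 0 < r := hr ▸ Real.sqrt_pos.2 (by exact_mod_cast hs)
  have hmr : 0 < √m := Real.sqrt_pos.2 hm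
  obtain ⟨θ, hθ⟩ : ∃ θ, θ = 1 - 5 * κ / 4 := ⟨_, rfl⟩
  have hθ0 : 0 < θ := by rw [hθ]; linarith
  have hθ1 : θ ≤ 1 := by rw [hθ]; linarith
  rw [← hθ, ← hr]
  set h := x₀ - x with hh
  have hE : l2 (M.mulVec h) ≤ 2 * η := by
    have e1 : M.mulVec h = (M.mulVec x₀ + e - M.mulVec x) - e := by
      rw [hh, Matrix.mulVec_sub]; abel
    rw [e1]
    refine (l2_sub_le _ _).trans ?_
    linarith [hx.1]
  have hopt : l1 x ≤ l1 x₀ := hx.2 x₀ (by simpa using he)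
  obtain ⟨S₀, hS₀, htop, hmax⟩ := exists_top_set h hs
  have nsp := normOn_le_of_restricted_isometry M hs hm hL hκ0 hκ hlow hupp h S₀ hS₀ htop
  rw [← hr] at nsp htop
  obtain ⟨A, hA⟩ : ∃ A, A = normOn S₀ h := ⟨_, rfl⟩
  have hA0 : 0 ≤ A := hA ▸ normOn_nonneg _ _
  obtain ⟨σ, hσ⟩ : ∃ σ, σ = ∑ i ∈ S₀ᶜ, |h i| := ⟨_, rfl⟩
  have hσ0 : 0 ≤ σ := hσ ▸ Finset.sum_nonneg fun _ _ => abs_nonneg _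
  rw [← hA, ← hσ] at nsp
  rw [← hA] at htop
  have hS₀1 : ∑ i ∈ S₀, |h i| ≤ r * A := by
    have h1 := Finset.sum_mul_sq_le_sq_mul_sq S₀ (fun _ => (1 : ℝ)) fun i => |h i|
    simp only [one_mul, one_pow, Finset.sum_const, nsmul_eq_mul, mul_one, sq_abs] at h1
    rw [← sq_normOn, ← hA] at h1
    refine abs_le_of_sq_le_sq' (h1.trans ?_) (by positivity) |>.2
    rw [mul_pow, hr, Real.sq_sqrt (by positivity)]
    have : (S₀.card : ℝ) ≤ s := by exact_mod_cast hS₀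
    exact mul_le_mul_of_nonneg_right this (sq_nonneg A)
  have htot : ∀ f : Fin p → ℝ, ∀ S : Finset (Fin p), ∑ i, f i = ∑ i ∈ S, f i + ∑ i ∈ Sᶜ, f i :=
    fun f S => (Finset.sum_add_sum_compl S f).symm
  have hl1 : l1 h ≤ r * A + σ := by
    rw [l1_eq, htot _ S₀, ← hσ]
    linarith
  have hl2 : r * l2 h ≤ 3 / 2 * (r * A) + σ / 2 := by
    have h1 : l2 h ^ 2 ≤ A ^ 2 + A / r * σ := by
      rw [sq_l2, htot _ S₀, ← sq_normOn, ← hA, hσ, Finset.mul_sum]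
      refine add_le_add le_rfl (Finset.sum_le_sum fun i hi => ?_)
      rw [← sq_abs, sq]
      exact mul_le_mul_of_nonneg_right (htop i (Finset.mem_compl.1 hi)) (abs_nonneg _)
    refine abs_le_of_sq_le_sq' ?_ (by positivity) |>.2
    have h2 : (r * l2 h) ^ 2 ≤ r ^ 2 * A ^ 2 + r * A * σ := by
      have := mul_le_mul_of_nonneg_left h1 (sq_nonneg r)
      have e1 : r ^ 2 * (A ^ 2 + A / r * σ) = r ^ 2 * A ^ 2 + r * A * σ := by field_simp
      rw [mul_pow]
      linarith
    nlinarith [mul_nonneg (mul_nonneg hr0.le hA0) hσ0, sq_nonneg σ, mul_nonneg hr0.le hA0]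
  have hηm : 0 ≤ η / √m := div_nonneg ((l2_nonneg e).trans he) hmr.le
  -- the common bound for both error norms, for an arbitrary sparse competitor `z`
  have main : ∀ z ∈ sparse p s, 2 * (r * A) + l1 (x₀ - z) * 2 ≤
      6 / θ * l1 (x₀ - z) + 4 / (√m * θ) * r * η ∧ σ ≤ r * A + 2 * l1 (x₀ - z) := by
    intro z hz
    obtain ⟨b, hb⟩ : ∃ b, b = l1 (x₀ - z) := ⟨_, rfl⟩
    have hb0 : 0 ≤ b := by rw [hb, l1_eq]; exact Finset.sum_nonneg fun _ _ => abs_nonneg _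
    classical
    let S : Finset (Fin p) := Finset.univ.filter fun i => z i ≠ 0
    have hSc : S.card ≤ s := by
      have : {i | z i ≠ 0} = (S : Set (Fin p)) := by ext i; simp [S]
      have hz' : {i | z i ≠ 0}.ncard ≤ s := hz
      rwa [this, Set.ncard_coe_finset] at hz'
    have hbS : ∑ i ∈ Sᶜ, |x₀ i| ≤ b := by
      rw [hb, l1_eq, htot _ S]
      have : ∑ i ∈ Sᶜ, |x₀ i| = ∑ i ∈ Sᶜ, |(x₀ - z) i| := Finset.sum_congr rfl fun i hi => by
        have : z i = 0 := by simpa [S] using hi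
        simp [this]
      rw [this]
      have : 0 ≤ ∑ i ∈ S, |(x₀ - z) i| := Finset.sum_nonneg fun _ _ => abs_nonneg _
      linarith
    have hcone : ∑ i ∈ Sᶜ, |h i| ≤ ∑ i ∈ S, |h i| + 2 * ∑ i ∈ Sᶜ, |x₀ i| := by
      have h1 : l1 x₀ ≥ ∑ i ∈ S, (|x₀ i| - |h i|) + ∑ i ∈ Sᶜ, (|h i| - |x₀ i|) := by
        refine le_trans ?_ hopt
        rw [l1_eq, htot _ S]
        refine add_le_add (Finset.sum_le_sum fun i _ => ?_) (Finset.sum_le_sum fun i _ => ?_)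
        · have : h i = x₀ i - x i := rfl
          have := abs_sub_abs_le_abs_sub (x₀ i) (h i)
          have e1 : x₀ i - h i = x i := by simp [hh]
          rwa [e1] at this
        · have := abs_sub_abs_le_abs_sub (h i) (x₀ i)
          have e1 : h i - x₀ i = -x i := by simp [hh]
          rwa [e1, abs_neg] at this
      rw [l1_eq, htot _ S, Finset.sum_sub_distrib, Finset.sum_sub_distrib] at h1
      linarith
    have hσb : σ ≤ r * A + 2 * b := by
      have h1 := hmax S hSc
      have h2 := htot (fun i => |h i|) S
      have h3 := htot (fun i => |h i|) S₀
      rw [← hσ] at h3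
      linarith
    refine ⟨?_, by rw [← hb]; exact hσb⟩
    rw [← hb]
    -- `a = r A` satisfies `θ a ≤ 2 κ b + 2 r η / √m`
    have h1 : r * A * (1 - κ / 4) ≤ κ * σ + 2 * r * (η / √m) := by
      have h2 := mul_le_mul_of_nonneg_left nsp hr0.le
      have e1 : r * (κ * (σ / r) + l2 (M.mulVec h) / √m) = κ * σ + r * (l2 (M.mulVec h) / √m) := by
        field_simp
      rw [e1] at h2
      have h3 : r * (l2 (M.mulVec h) / √m) ≤ r * (2 * η / √m) :=
        mul_le_mul_of_nonneg_left (div_le_div_of_nonneg_right hE hmr.le) hr0.le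
      have e2 : r * (2 * η / √m) = 2 * r * (η / √m) := by ring
      linarith
    have h2 : r * A * θ ≤ 8 / 5 * b + 2 * r * (η / √m) := by
      rw [hθ]
      nlinarith [mul_le_mul_of_nonneg_left hσb hκ0]
    have e3 : 6 / θ * b + 4 / (√m * θ) * r * η = (6 * b + 4 * r * (η / √m)) / θ := by
      field_simp
    rw [e3, le_div_iff₀ hθ0]
    nlinarith
  have hC : 0 < 6 / θ := by positivity
  have hne : ((fun z => l1 (x₀ - z)) '' sparse p s).Nonempty :=
    ⟨_, 0, mem_sparse_of_support ∅ (by simp) fun _ _ => rfl, rfl⟩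
  have pass : ∀ {a c : ℝ}, (∀ z ∈ sparse p s, a ≤ 6 / θ * l1 (x₀ - z) + c) →
      a ≤ 6 / θ * bestApprox s x₀ + c := by
    intro a c hac
    have : (a - c) / (6 / θ) ≤ bestApprox s x₀ := by
      refine le_csInf hne ?_
      rintro _ ⟨z, hz, rfl⟩
      rw [div_le_iff₀ hC]
      linarith [hac z hz]
    rw [div_le_iff₀ hC] at this
    linarith
  constructor
  · refine pass fun z hz => ?_
    obtain ⟨h1, h2⟩ := main z hz
    linarith
  · have := pass (a := r * l2 h) (c := 4 / (√m * θ) * r * η) fun z hz => by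
      obtain ⟨h1, h2⟩ := main z hz
      have hb0 : 0 ≤ l1 (x₀ - z) := by
        rw [l1_eq]; exact Finset.sum_nonneg fun _ _ => abs_nonneg _
      linarith
    refine le_of_mul_le_mul_left (this.trans_eq ?_) hr0
    field_simp

/-! ### Restricted isometry constants of a Gaussian matrix -/

theorem IsStdGaussianMatrix.map_eq {Ω : Type u} [MeasurableSpace Ω] {n p : ℕ} {P : Measure Ω}
    [IsProbabilityMeasure P] {G : Ω → Matrix (Fin n) (Fin p) ℝ} (hG : IsStdGaussianMatrix P G) :
    P.map (fun ω (k : Fin n × Fin p) => G ω k.1 k.2) = stdGaussian (Fin n × Fin p) := by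
  have h := (iIndepFun_iff_map_fun_eq_pi_map
    (fun k : Fin n × Fin p => (hG.1 k.1 k.2).aemeasurable)).1 hG.2
  rw [h]
  exact congrArg Measure.pi (funext fun k => (hG.1 k.1 k.2).map_eq)

theorem IsStdGaussianMatrix.measureReal_le {Ω : Type u} [MeasurableSpace Ω] {n p : ℕ}
    {P : Measure Ω} [IsProbabilityMeasure P] {G : Ω → Matrix (Fin n) (Fin p) ℝ}
    (hG : IsStdGaussianMatrix P G) {E : Set Ω} {A : Set (Fin n × Fin p → ℝ)}
    (h : ∀ ω ∈ E, (fun k : Fin n × Fin p => G ω k.1 k.2) ∈ A) :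
    P.real E ≤ (stdGaussian (Fin n × Fin p)).real A := by
  have hm : AEMeasurable (fun ω (k : Fin n × Fin p) => G ω k.1 k.2) P :=
    aemeasurable_pi_lambda _ fun k => (hG.1 k.1 k.2).aemeasurable
  refine ENNReal.toReal_mono (measure_ne_top _ _) ?_
  rw [← hG.map_eq]
  exact (measure_mono h).trans (Measure.le_map_apply hm A)

theorem exists_sparseSphere {n p s : ℕ} (hsp : s ≤ p) (M : Matrix (Fin n) (Fin p) ℝ)
    {x : Fin p → ℝ} (hx : x ∈ sparse p s) (h0 : 0 < l2 x) :
    ∃ v ∈ sparseSphere (Fin p) s, l2 ((scaled M).mulVec x) ^ 2 =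
      l2 x ^ 2 * (normMul v (fun k => M k.1 k.2) ^ 2 / n) := by
  classical
  let S : Finset (Fin p) := Finset.univ.filter fun i => x i ≠ 0
  have hSc : S.card ≤ s := by
    have : {i | x i ≠ 0} = (S : Set (Fin p)) := by ext i; simp [S]
    have hz' : {i | x i ≠ 0}.ncard ≤ s := hx
    rwa [this, Set.ncard_coe_finset] at hz'
  obtain ⟨T, hST, hT⟩ := Finset.exists_superset_card_eq hSc (by simpa using hsp)
  refine ⟨fun j => x j / l2 x, ⟨?_, T, hT, fun j hj => ?_⟩, ?_⟩
  · simp only [div_pow, ← Finset.sum_div]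
    rw [← sq_l2, div_self (by positivity)]
  · have : x j = 0 := by
      by_contra h
      exact hj (hST (by simp [S, h]))
    simp [this]
  · rw [normMul, Real.sq_sqrt (Finset.sum_nonneg fun _ _ => sq_nonneg _), sq_l2, Finset.sum_div,
      Finset.mul_sum]
    refine Finset.sum_congr rfl fun i _ => ?_
    have e : (scaled M).mulVec x i = (1 / √(n : ℝ)) * ∑ j, M i j * x j := by
      simp [scaled, Matrix.mulVec, dotProduct, Finset.mul_sum, mul_assoc]
    simp only [mul_div_assoc', ← Finset.sum_div]
    rw [e, mul_pow, div_pow, div_pow, one_pow, Real.sq_sqrt (Nat.cast_nonneg n)]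
    field_simp

theorem measureReal_lt_cMax_le {Ω : Type u} [MeasurableSpace Ω] {n p s : ℕ} {P : Measure Ω}
    [IsProbabilityMeasure P] {G : Ω → Matrix (Fin n) (Fin p) ℝ} (hG : IsStdGaussianMatrix P G)
    (hn : 0 < n) (hsp : s ≤ p) {t c : ℝ} (ht : 0 < t) (hc : 0 ≤ c)
    (hct : √(n : ℝ) + √(s : ℝ) + t ≤ √(n : ℝ) * √(1 + c)) :
    P.real {ω | c < cMax s (scaled (G ω))} ≤ p.choose s * Real.exp (-(t ^ 2 / 2)) := by
  have key := measureReal_lt_normMul_le (m := Fin n) (q := Fin p) s ht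
  simp only [Fintype.card_fin] at key
  refine (hG.measureReal_le fun ω hω => ?_).trans key
  obtain ⟨x, hx, hlt⟩ := exists_of_lt_cMax _ hc hω
  have h0 : 0 < l2 x := by
    refine lt_of_le_of_ne (l2_nonneg x) fun h => ?_
    have := cMax_spec (scaled (G ω)) hx
    rw [← h] at hlt this
    linarith
  obtain ⟨v, hv, e⟩ := exists_sparseSphere hsp (G ω) hx h0
  refine ⟨v, hv, hct.trans_lt ?_⟩
  have hn' : (0 : ℝ) < n := by exact_mod_cast hn
  rw [e, mul_comm (1 + c)] at hlt
  have h1 := lt_of_mul_lt_mul_left hlt (sq_nonneg _)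
  rw [lt_div_iff₀ hn', mul_comm] at h1
  rw [← Real.sqrt_mul hn'.le]
  refine (Real.sqrt_lt_sqrt (by positivity) h1).trans_eq ?_
  exact Real.sqrt_sq (Real.sqrt_nonneg _)

theorem measureReal_lt_cMin_le {Ω : Type u} [MeasurableSpace Ω] {n p s : ℕ} {P : Measure Ω}
    [IsProbabilityMeasure P] {G : Ω → Matrix (Fin n) (Fin p) ℝ} (hG : IsStdGaussianMatrix P G)
    (hn : 0 < n) (hsp : s ≤ p) {t c : ℝ} (ht : 0 < t) (hc : 0 ≤ c)
    (hct : √(n : ℝ) * √(1 - c) ≤ √(n : ℝ) - √(s : ℝ) - t) :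
    P.real {ω | c < cMin s (scaled (G ω))} ≤
      p.choose s * ((n + 2) * Real.exp t) * Real.exp (-(t ^ 2 / 2)) := by
  have : Nonempty (Fin n) := ⟨⟨0, hn⟩⟩
  have key := measureReal_normMul_lt_le (m := Fin n) (q := Fin p) s ht
  simp only [Fintype.card_fin] at key
  refine (hG.measureReal_le fun ω hω => ?_).trans key
  obtain ⟨x, hx, hlt⟩ := exists_of_lt_cMin _ hc hω
  have h0 : 0 < l2 x := by
    refine lt_of_le_of_ne (l2_nonneg x) fun h => ?_
    rw [← h] at hlt
    nlinarith [sq_nonneg (l2 ((scaled (G ω)).mulVec x))]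
  obtain ⟨v, hv, e⟩ := exists_sparseSphere hsp (G ω) hx h0
  refine ⟨v, hv, lt_of_lt_of_le ?_ hct⟩
  have hn' : (0 : ℝ) < n := by exact_mod_cast hn
  rw [e, mul_comm (1 - c)] at hlt
  have h1 := lt_of_mul_lt_mul_left hlt (sq_nonneg _)
  rw [div_lt_iff₀ hn', mul_comm] at h1
  rw [← Real.sqrt_mul hn'.le]
  refine lt_of_eq_of_lt ?_ (Real.sqrt_lt_sqrt (sq_nonneg _) h1)
  exact (Real.sqrt_sq (Real.sqrt_nonneg _)).symm

/-! ### Entropy asymptotics -/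

theorem choose_le_exp_binEntropy {p s : ℕ} (hs : s ≤ p) :
    (p.choose s : ℝ) ≤ Real.exp (p * Real.binEntropy (s / p)) := by
  rcases Nat.eq_zero_or_pos s with rfl | h0
  · simp
  rcases hs.eq_or_lt with rfl | hlt
  · have : (s : ℝ) ≠ 0 := by exact_mod_cast h0.ne'
    simp [this]
  have hp : (0 : ℝ) < p := by exact_mod_cast (h0.trans hlt)
  have hs0 : (0 : ℝ) < s := by exact_mod_cast h0
  have hsp : (s : ℝ) < p := by exact_mod_cast hlt
  obtain ⟨q, hq⟩ : ∃ q : ℝ, q = s / p := ⟨_, rfl⟩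
  have hq0 : 0 < q := by rw [hq]; positivity
  have hq1 : 0 < 1 - q := by rw [hq, sub_pos, div_lt_one hp]; exact hsp
  have hqp : (p : ℝ) * q = s := by rw [hq]; field_simp
  rw [← hq]
  -- one term of the binomial expansion of `(q + (1 - q)) ^ p = 1`
  have h1 : q ^ s * (1 - q) ^ (p - s) * p.choose s ≤ 1 := by
    have := Finset.single_le_sum (f := fun k => q ^ k * (1 - q) ^ (p - k) * (p.choose k : ℝ))
      (fun k _ => by positivity) (Finset.mem_range.2 (by omega : s < p + 1))
    rw [← add_pow, add_sub_cancel, one_pow] at this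
    exact this
  have h2 : q ^ s * (1 - q) ^ (p - s) = Real.exp (-(p * Real.binEntropy q)) := by
    have e1 : q ^ s = Real.exp (s * Real.log q) := by rw [Real.exp_nat_mul, Real.exp_log hq0]
    have e2 : (1 - q) ^ (p - s) = Real.exp ((p - s : ℕ) * Real.log (1 - q)) := by
      rw [Real.exp_nat_mul, Real.exp_log hq1]
    rw [e1, e2, ← Real.exp_add, Real.binEntropy, Real.log_inv, Real.log_inv, Nat.cast_sub hs, ← hqp]
    congr 1
    ring
  rw [h2, Real.exp_neg, inv_mul_le_iff₀ (Real.exp_pos _), mul_one] at h1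
  exact h1

theorem eventually_choose_le {r δ : ℝ} (hr0 : 0 < r) (hr1 : r < 1) (hδ0 : 0 < δ) (hδ1 : δ < 1)
    {e : ℝ} (he : 0 < e) (p : ℕ → ℕ)
    (hp : Tendsto (fun n : ℕ => (n : ℝ) / (p n : ℝ)) atTop (𝓝 δ)) :
    ∀ᶠ n : ℕ in atTop, ⌊r * (n : ℝ)⌋₊ ≤ p n ∧ ((p n).choose ⌊r * (n : ℝ)⌋₊ : ℝ) ≤
      Real.exp (n * (tZero r δ ^ 2 / 2 + e)) := by
  have hH : 0 ≤ Real.binEntropy (r * δ) :=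
    Real.binEntropy_nonneg (by positivity) (by nlinarith)
  have ht0 : tZero r δ ^ 2 / 2 = Real.binEntropy (r * δ) / δ := by
    rw [tZero, Real.sq_sqrt (by positivity)]; ring
  have h1 : Tendsto (fun n : ℕ => (⌊r * (n : ℝ)⌋₊ : ℝ) / n) atTop (𝓝 r) :=
    (tendsto_nat_floor_mul_div_atTop hr0.le).comp tendsto_natCast_atTop_atTop
  have h2 : Tendsto (fun n : ℕ => (⌊r * (n : ℝ)⌋₊ : ℝ) / n * ((n : ℝ) / p n)) atTop
      (𝓝 (r * δ)) := h1.mul hp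
  have h3 : Tendsto (fun n : ℕ => Real.binEntropy ((⌊r * (n : ℝ)⌋₊ : ℝ) / n * ((n : ℝ) / p n)) /
      ((n : ℝ) / p n)) atTop (𝓝 (Real.binEntropy (r * δ) / δ)) :=
    ((Real.binEntropy_continuous.tendsto _).comp h2).div hp hδ0.ne'
  filter_upwards [eventually_gt_atTop 0, h3.eventually_lt_const (by linarith :
      Real.binEntropy (r * δ) / δ < Real.binEntropy (r * δ) / δ + e),
    hp.eventually_lt_const hδ1, hp.eventually_const_lt hδ0] with n hn hlt hnp hnp0
  have hn' : (0 : ℝ) < n := by exact_mod_cast hn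
  have hp0 : (0 : ℝ) < p n := by
    by_contra h
    have : (p n : ℝ) = 0 := le_antisymm (not_lt.1 h) (Nat.cast_nonneg _)
    rw [this, div_zero] at hnp0
    exact lt_irrefl _ hnp0
  have hle : ⌊r * (n : ℝ)⌋₊ ≤ p n := by
    rw [div_lt_one hp0] at hnp
    have h4 : (⌊r * (n : ℝ)⌋₊ : ℝ) ≤ r * n := Nat.floor_le (by positivity)
    have : (⌊r * (n : ℝ)⌋₊ : ℝ) ≤ p n := by nlinarith
    exact_mod_cast this
  refine ⟨hle, (choose_le_exp_binEntropy hle).trans (Real.exp_le_exp.2 ?_)⟩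
  rw [ht0]
  have e1 : (⌊r * (n : ℝ)⌋₊ : ℝ) / n * ((n : ℝ) / p n) = ⌊r * (n : ℝ)⌋₊ / p n := by field_simp
  rw [e1] at hlt
  have e2 : (p n : ℝ) * Real.binEntropy (⌊r * (n : ℝ)⌋₊ / p n) =
      n * (Real.binEntropy (⌊r * (n : ℝ)⌋₊ / p n) / (n / p n)) := by field_simp
  rw [e2]
  exact mul_le_mul_of_nonneg_left hlt.le hn'.le

/-! ### Tails of the restricted isometry constants -/

theorem tZero_nonneg (r δ : ℝ) : 0 ≤ tZero r δ := Real.sqrt_nonneg _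

/-- Exponential tails of both restricted isometry constants beyond their values at `√r + t₀`. The
exponent `t₀² / 2` of the union bound is beaten by the Gaussian tail at `t₀ + e`. -/
theorem eventually_measureReal_le {r δ e : ℝ} (hr0 : 0 < r) (hr1 : r < 1) (hδ0 : 0 < δ)
    (hδ1 : δ < 1) (he : 0 < e) (p : ℕ → ℕ)
    (hp : Tendsto (fun n : ℕ => (n : ℝ) / (p n : ℝ)) atTop (𝓝 δ)) :
    ∀ᶠ n : ℕ in atTop, ∀ (Ω : Type u) [MeasurableSpace Ω] (P : Measure Ω) [IsProbabilityMeasure P]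
      (G : Ω → Matrix (Fin n) (Fin (p n)) ℝ), IsStdGaussianMatrix P G →
      P.real {ω | (1 + (√r + tZero r δ + e)) ^ 2 - 1 < cMax ⌊r * (n : ℝ)⌋₊ (scaled (G ω))} ≤
        2 * Real.exp (-(n : ℝ) * (e ^ 2 / 8)) ∧
      (√r + tZero r δ + e ≤ 1 →
        P.real {ω | 1 - (1 - (√r + tZero r δ + e)) ^ 2 < cMin ⌊r * (n : ℝ)⌋₊ (scaled (G ω))} ≤
          2 * Real.exp (-(n : ℝ) * (e ^ 2 / 8))) := by
  obtain ⟨τ, hτ⟩ : ∃ τ, τ = tZero r δ := ⟨_, rfl⟩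
  have hτ0 : 0 ≤ τ := hτ ▸ tZero_nonneg r δ
  have hlarge : ∀ᶠ n : ℕ in atTop, (τ + e + 1) / (e ^ 2 / 8) ≤ √(n : ℝ) :=
    (Real.tendsto_sqrt_atTop.comp tendsto_natCast_atTop_atTop).eventually_ge_atTop _
  filter_upwards [eventually_gt_atTop 0,
    eventually_choose_le hr0 hr1 hδ0 hδ1 (by positivity : 0 < e ^ 2 / 4) p hp, hlarge]
    with n hn hch hln Ω _ P _ G hG
  obtain ⟨hsp, hch⟩ := hch
  rw [← hτ] at hch ⊢
  have hn' : (0 : ℝ) < n := by exact_mod_cast hn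
  obtain ⟨w, hw⟩ : ∃ w, w = √(n : ℝ) := ⟨_, rfl⟩
  have hw0 : 0 < w := hw ▸ Real.sqrt_pos.2 hn'
  have hw2 : (n : ℝ) = w ^ 2 := by rw [hw, Real.sq_sqrt hn'.le]
  obtain ⟨s, hs⟩ : ∃ s, s = ⌊r * (n : ℝ)⌋₊ := ⟨_, rfl⟩
  rw [← hs] at hsp hch ⊢
  have hsw : √(s : ℝ) ≤ √r * w := by
    rw [hw, ← Real.sqrt_mul hr0.le, hs]
    exact Real.sqrt_le_sqrt (Nat.floor_le (by positivity))
  have hr' := Real.sqrt_nonneg r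
  have ht : 0 < w * (τ + e) := by positivity
  rw [← hw] at hln
  rw [div_le_iff₀ (by positivity)] at hln
  have hexp : Real.exp (n * (τ ^ 2 / 2 + e ^ 2 / 4)) * Real.exp (-((w * (τ + e)) ^ 2 / 2)) ≤
      Real.exp (-(n : ℝ) * (e ^ 2 / 4)) := by
    rw [← Real.exp_add, hw2]
    refine Real.exp_le_exp.2 ?_
    have : 0 ≤ w ^ 2 * (τ * e) := by positivity
    nlinarith
  constructor
  · have h := measureReal_lt_cMax_le hG hn hsp ht
      (c := (1 + (√r + τ + e)) ^ 2 - 1) (by nlinarith) (by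
        rw [← hw, add_sub_cancel, Real.sqrt_sq (by positivity)]
        nlinarith)
    have h2 : Real.exp (-(n : ℝ) * (e ^ 2 / 4)) ≤ Real.exp (-(n : ℝ) * (e ^ 2 / 8)) :=
      Real.exp_le_exp.2 (by nlinarith [mul_pos hn' (sq_pos_of_pos he)])
    have h3 := mul_le_mul_of_nonneg_right hch (Real.exp_pos (-((w * (τ + e)) ^ 2 / 2))).le
    linarith [Real.exp_pos (-(n : ℝ) * (e ^ 2 / 8))]
  · intro hle
    have h := measureReal_lt_cMin_le hG hn hsp ht
      (c := 1 - (1 - (√r + τ + e)) ^ 2) (by nlinarith) (by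
        rw [← hw, sub_sub_cancel, Real.sqrt_sq (by linarith)]
        nlinarith)
    refine h.trans ?_
    have hn2 : (n : ℝ) + 2 ≤ 2 * Real.exp w := by
      have := Real.quadratic_le_exp_of_nonneg hw0.le
      rw [hw2]; linarith
    have h4 : Real.exp w * Real.exp (w * (τ + e)) ≤ Real.exp (n * (e ^ 2 / 8)) := by
      rw [← Real.exp_add, hw2]
      exact Real.exp_le_exp.2 (by nlinarith)
    calc ((p n).choose s : ℝ) * ((n + 2) * Real.exp (w * (τ + e))) *
          Real.exp (-((w * (τ + e)) ^ 2 / 2))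
        ≤ Real.exp (n * (τ ^ 2 / 2 + e ^ 2 / 4)) * ((2 * Real.exp w) * Real.exp (w * (τ + e))) *
          Real.exp (-((w * (τ + e)) ^ 2 / 2)) := by gcongr
      _ = 2 * (Real.exp w * Real.exp (w * (τ + e))) * (Real.exp (n * (τ ^ 2 / 2 + e ^ 2 / 4)) *
          Real.exp (-((w * (τ + e)) ^ 2 / 2))) := by ring
      _ ≤ 2 * Real.exp (n * (e ^ 2 / 8)) * Real.exp (-(n : ℝ) * (e ^ 2 / 4)) := by gcongr
      _ = 2 * Real.exp (-(n : ℝ) * (e ^ 2 / 8)) := by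
        rw [mul_assoc, ← Real.exp_add]
        congr 2; ring

theorem cMin_le_one {n p : ℕ} (s : ℕ) (M : Matrix (Fin n) (Fin p) ℝ) : cMin s M ≤ 1 :=
  csInf_le bddBelow_of_nonneg ⟨zero_le_one, fun x _ => by rw [sub_self, zero_mul]; positivity⟩

/-! ### The threshold and the recovery constants -/

/-- The threshold for the sum `√r + t₀`, at which the bound for `γ` reaches `(4 + √41)² / 25`. -/
theorem sqrt_threshold_eq : √((33 - 5 * √41) / 8) = (√41 - 1) / (√41 + 9) := by
  have h41 : √41 ^ 2 = 41 := Real.sq_sqrt (by norm_num)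
  have h1 : 1 < √41 := by
    rw [Real.lt_sqrt (by norm_num)]; norm_num
  rw [Real.sqrt_eq_iff_mul_self_eq_of_pos (by have := sub_pos.2 h1; positivity)]
  field_simp
  nlinarith

theorem binEntropy_le {q : ℝ} (h1 : q < 1) :
    Real.binEntropy q ≤ q * (1 - Real.log q) := by
  have h := Real.one_sub_inv_le_log_of_pos (sub_pos.2 h1)
  have h2 := mul_le_mul_of_nonneg_left h (sub_pos.2 h1).le
  have e : (1 - q) * (1 - (1 - q)⁻¹) = -q := by
    have := (sub_pos.2 h1).ne'
    field_simp
    ring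
  rw [Real.binEntropy, Real.log_inv, Real.log_inv]
  linarith

/-- The explicit condition on `(ρ, δ)` places `√(2ρ) + t₀` below the threshold. -/
theorem sqrt_add_tZero_lt {ρ δ : ℝ} (hρ0 : 0 < ρ) (hρ1 : ρ < (33 - 5 * √41) / 16) (hδ0 : 0 < δ)
    (hδ1 : δ < 1)
    (h : 1 / (2 * ρ) * Real.exp
      (1 - 1 / (4 * ρ) * (√((33 - 5 * √41) / 8) - √(2 * ρ)) ^ 2) < δ) :
    √(2 * ρ) + tZero (2 * ρ) δ < √((33 - 5 * √41) / 8) := by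
  have h41 : 6 < √41 := by rw [Real.lt_sqrt (by norm_num)]; norm_num
  obtain ⟨A, hA⟩ : ∃ A, A = √((33 - 5 * √41) / 8) := ⟨_, rfl⟩
  rw [← hA] at h ⊢
  have hlt : √(2 * ρ) < A := by
    rw [hA]; exact Real.sqrt_lt_sqrt (by positivity) (by linarith)
  have hq0 : 0 < 2 * ρ * δ := by positivity
  have hq1 : 2 * ρ * δ < 1 := by nlinarith
  have h2 : 1 - 1 / (4 * ρ) * (A - √(2 * ρ)) ^ 2 < Real.log (2 * ρ * δ) := by
    rw [Real.lt_log_iff_exp_lt hq0]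
    rw [one_div_mul_eq_div, div_lt_iff₀ (by positivity)] at h
    linarith
  have h3 : 4 * ρ * (1 - Real.log (2 * ρ * δ)) < (A - √(2 * ρ)) ^ 2 := by
    have h4 : 1 - Real.log (2 * ρ * δ) < (A - √(2 * ρ)) ^ 2 / (4 * ρ) := by
      rw [one_div_mul_eq_div] at h2; linarith
    rw [lt_div_iff₀ (by positivity)] at h4
    linarith
  have h5 : tZero (2 * ρ) δ < A - √(2 * ρ) := by
    rw [tZero, Real.sqrt_lt' (by linarith)]
    refine lt_of_le_of_lt ?_ h3
    rw [div_le_iff₀ hδ0]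
    have := binEntropy_le hq1
    nlinarith
  linarith

/-- The constant `κ = (√γ - 1 / √γ) / 2`, where `γ = (1 + b) / (1 - a)`. -/
noncomputable def kappa (a b : ℝ) : ℝ := (√((1 + b) / (1 - a)) - (√((1 + b) / (1 - a)))⁻¹) / 2

theorem kappa_spec {a b : ℝ} (ha0 : 0 ≤ a) (ha1 : a < 1) (hb : 0 ≤ b) :
    0 ≤ kappa a b ∧ 4 * (1 + b) * (1 - a) * kappa a b ^ 2 = ((1 + b) - (1 - a)) ^ 2 := by
  have hm : 0 < 1 - a := by linarith
  obtain ⟨g, hg⟩ : ∃ g, g = √((1 + b) / (1 - a)) := ⟨_, rfl⟩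
  have hg1 : 1 ≤ g := by
    rw [hg, Real.one_le_sqrt, le_div_iff₀ hm]; linarith
  have hg2 : 1 + b = g ^ 2 * (1 - a) := by
    rw [hg, Real.sq_sqrt (by positivity)]; field_simp
  have hg0 : 0 < g := by linarith
  rw [kappa, ← hg]
  constructor
  · have : g⁻¹ ≤ 1 := inv_le_one_of_one_le₀ hg1
    linarith
  · rw [hg2]
    field_simp
    ring

theorem kappa_le {a b g : ℝ} (ha1 : a < 1) (hb : 0 ≤ b) (hg : √((1 + b) / (1 - a)) ≤ g) :
    kappa a b ≤ (g - g⁻¹) / 2 := by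
  have h0 : 0 < √((1 + b) / (1 - a)) :=
    Real.sqrt_pos.2 (div_pos (by linarith) (by linarith))
  have := inv_anti₀ h0 hg
  rw [kappa]
  linarith

theorem half_sub_inv_lt {g : ℝ} (hg0 : 0 < g) (hg : g < (4 + √41) / 5) :
    (g - g⁻¹) / 2 < 4 / 5 := by
  have h41 : √41 ^ 2 = 41 := Real.sq_sqrt (by norm_num)
  have h1 : 6 < √41 := by rw [Real.lt_sqrt (by norm_num)]; norm_num
  have h2 : g ^ 2 - 8 / 5 * g - 1 < 0 := by
    have e : g ^ 2 - 8 / 5 * g - 1 = (g - (4 + √41) / 5) * (g + (√41 - 4) / 5) := by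
      linear_combination (1 / 25) * h41
    rw [e]
    exact mul_neg_of_neg_of_pos (by linarith) (by linarith)
  have h3 : g - g⁻¹ - 8 / 5 = (g ^ 2 - 8 / 5 * g - 1) / g := by
    field_simp
    ring
  have := div_neg_of_neg_of_pos h2 hg0
  linarith

open Classical in
/-- The constant `C` of sparse recovery as a function of the restricted isometry constants. Outside
the range of the recovery theorem the value is set to `1`. -/
noncomputable def recoveryC (a b : ℝ) : ℝ :=
  if a < 1 ∧ kappa a b < 4 / 5 then 6 / (1 - 5 * kappa a b / 4) else 1

open Classical in
/-- The constant `D` of sparse recovery as a function of the restricted isometry constants. Outside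
the range of the recovery theorem the value is set to `1`. -/
noncomputable def recoveryD (a b : ℝ) : ℝ :=
  if a < 1 ∧ kappa a b < 4 / 5 then 4 / (√(1 - a) * (1 - 5 * kappa a b / 4)) else 1

theorem recoveryC_pos (a b : ℝ) : 0 < recoveryC a b := by
  unfold recoveryC
  split_ifs with h
  · have : 0 < 1 - 5 * kappa a b / 4 := by linarith [h.2]
    positivity
  · exact one_pos

theorem recoveryD_pos (a b : ℝ) : 0 < recoveryD a b := by
  unfold recoveryD
  split_ifs with h
  · have h1 : 0 < 1 - 5 * kappa a b / 4 := by linarith [h.2]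
    have h2 : 0 < √(1 - a) := Real.sqrt_pos.2 (by linarith [h.1])
    positivity
  · exact one_pos

/-- All conclusions for one matrix and one sparsity level, from bounds on the restricted isometry
constants in terms of `b` below the threshold `(√41 - 1) / (√41 + 9)`. -/
theorem recovery_of_le {n p s : ℕ} (M : Matrix (Fin n) (Fin p) ℝ) {b : ℝ} (hb0 : 0 ≤ b)
    (hb : b < (√41 - 1) / (√41 + 9)) (hmin : cMin (2 * s) M ≤ 1 - (1 - b) ^ 2)
    (hmax : cMax (2 * s) M ≤ (1 + b) ^ 2 - 1) {g : ℝ} (hg : g = (1 + b) / (1 - b)) :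
    GammaCondition s M ∧ (1 ≤ s →
      recoveryC (cMin (2 * s) M) (cMax (2 * s) M) ≤ 6 / (1 - 5 * ((g - g⁻¹) / 2) / 4) ∧
      recoveryD (cMin (2 * s) M) (cMax (2 * s) M) ≤
        4 / ((1 - b) * (1 - 5 * ((g - g⁻¹) / 2) / 4)) ∧
      SRSR M s (recoveryC (cMin (2 * s) M) (cMax (2 * s) M))
        (recoveryD (cMin (2 * s) M) (cMax (2 * s) M))) := by
  have h41 : √41 ^ 2 = 41 := Real.sq_sqrt (by norm_num)
  have h1 : 6 < √41 := by rw [Real.lt_sqrt (by norm_num)]; norm_num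
  rw [lt_div_iff₀ (by linarith)] at hb
  have hb1 : b < 1 := by nlinarith
  have hg0 : 0 < g := by rw [hg]; exact div_pos (by linarith) (by linarith)
  have hglt : g < (4 + √41) / 5 := by
    rw [hg, div_lt_div_iff₀ (by linarith) (by norm_num)]
    nlinarith
  have a0 := cMin_nonneg (2 * s) M
  have b0 := cMax_nonneg (2 * s) M
  have hb2 : 0 < (1 - b) ^ 2 := pow_pos (by linarith) 2
  have a1 : cMin (2 * s) M < 1 := by linarith
  have hγ : (1 + cMax (2 * s) M) / (1 - cMin (2 * s) M) ≤ g ^ 2 := by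
    rw [hg, div_pow, div_le_div_iff₀ (by linarith) hb2]
    exact mul_le_mul (by linarith) (by linarith) hb2.le (by positivity)
  have hsq : √((1 + cMax (2 * s) M) / (1 - cMin (2 * s) M)) ≤ g :=
    Real.sqrt_le_iff.2 ⟨hg0.le, hγ⟩
  have hκ1 := half_sub_inv_lt hg0 hglt
  have hκle := kappa_le a1 b0 hsq
  obtain ⟨hκ0, hκ⟩ := kappa_spec a0 a1 b0
  have hcond : cMin (2 * s) M < 1 ∧ kappa (cMin (2 * s) M) (cMax (2 * s) M) < 4 / 5 :=
    ⟨a1, hκle.trans_lt hκ1⟩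
  have hθ : 0 < 1 - 5 * ((g - g⁻¹) / 2) / 4 := by linarith
  refine ⟨⟨a1, hγ.trans_lt ?_⟩, fun hs => ⟨?_, ?_, ?_⟩⟩
  · have := pow_lt_pow_left₀ hglt hg0.le two_ne_zero
    refine this.trans_eq ?_
    ring
  · rw [recoveryC, if_pos hcond]
    exact div_le_div_of_nonneg_left (by norm_num) hθ (by linarith)
  · rw [recoveryD, if_pos hcond]
    have hmb : 1 - b ≤ √(1 - cMin (2 * s) M) := Real.le_sqrt_of_sq_le (by linarith)
    exact div_le_div_of_nonneg_left (by norm_num) (mul_pos (by linarith) hθ)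
      (mul_le_mul hmb (by linarith) hθ.le (Real.sqrt_nonneg _))
  · rw [recoveryC, recoveryD, if_pos hcond, if_pos hcond]
    exact srsr_of_restricted_isometry M hs (by linarith) (by linarith) hκ0 hcond.2 hκ
      (fun x hx => cMin_spec M hx) (fun x hx => cMax_spec M hx)

end SparseRecovery

theorem mainTheorem4 :
    (∃ C D : ℝ → ℝ → ℝ, (∀ a b, 0 < C a b ∧ 0 < D a b) ∧
      ∀ ρ δ : ℝ, 0 < ρ → ρ < (33 - 5 * √41) / 16 → 0 < δ → δ < 1 →
        1 / (2 * ρ) * Real.exp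
          (1 - 1 / (4 * ρ) * (√((33 - 5 * √41) / 8) - √(2 * ρ)) ^ 2) < δ →
        ∃ D₁ K : ℝ, 0 < D₁ ∧
          ∀ p : ℕ → ℕ, Tendsto (fun n : ℕ => (n : ℝ) / (p n : ℝ)) atTop (𝓝 δ) →
            ∀ᶠ n : ℕ in atTop,
              ∀ (Ω : Type u) [MeasurableSpace Ω] (P : Measure Ω) [IsProbabilityMeasure P]
                (G : Ω → Matrix (Fin n) (Fin (p n)) ℝ), IsStdGaussianMatrix P G →
                P.real {ω | ¬ ∀ s : ℕ, s ≤ ⌊ρ * (n : ℝ)⌋₊ →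
                  GammaCondition s (scaled (G ω)) ∧
                  (1 ≤ s →
                    C (cMin (2 * s) (scaled (G ω))) (cMax (2 * s) (scaled (G ω))) ≤ K ∧
                    D (cMin (2 * s) (scaled (G ω))) (cMax (2 * s) (scaled (G ω))) ≤ K ∧
                    SRSR (scaled (G ω)) s
                      (C (cMin (2 * s) (scaled (G ω))) (cMax (2 * s) (scaled (G ω))))
                      (D (cMin (2 * s) (scaled (G ω))) (cMax (2 * s) (scaled (G ω)))))}
                ≤ 4 * Real.exp (-(n : ℝ) * D₁)) ∧
    (∀ r δ ε : ℝ, 0 < r → r < 1 → 0 < δ → δ < 1 → 0 < ε →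
      ∃ D₂ : ℝ, 0 < D₂ ∧
        ∀ p : ℕ → ℕ, Tendsto (fun n : ℕ => (n : ℝ) / (p n : ℝ)) atTop (𝓝 δ) →
          ∀ᶠ n : ℕ in atTop,
            ∀ (Ω : Type u) [MeasurableSpace Ω] (P : Measure Ω) [IsProbabilityMeasure P]
              (G : Ω → Matrix (Fin n) (Fin (p n)) ℝ), IsStdGaussianMatrix P G →
              P.real {ω | (√r + tZero r δ) * (2 + √r + tZero r δ) + ε
                  ≤ cMax ⌊r * (n : ℝ)⌋₊ (scaled (G ω))}
                ≤ 2 * Real.exp (-(n : ℝ) * D₂) ∧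
              (√r + tZero r δ ≤ 1 →
                P.real {ω | (√r + tZero r δ) * (2 - √r - tZero r δ) + ε
                    ≤ cMin ⌊r * (n : ℝ)⌋₊ (scaled (G ω))}
                  ≤ 2 * Real.exp (-(n : ℝ) * D₂))) := by
  constructor
  · refine ⟨recoveryC, recoveryD, fun a b => ⟨recoveryC_pos a b, recoveryD_pos a b⟩, ?_⟩
    intro ρ δ hρ0 hρ1 hδ0 hδ1 hcond
    have hlt := sqrt_add_tZero_lt hρ0 hρ1 hδ0 hδ1 hcond
    rw [sqrt_threshold_eq] at hlt
    have h41 : 6 < √41 := by rw [Real.lt_sqrt (by norm_num)]; norm_num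
    obtain ⟨τ, hτ⟩ : ∃ τ, τ = √(2 * ρ) + tZero (2 * ρ) δ := ⟨_, rfl⟩
    have hτ0 : 0 ≤ τ := hτ ▸ add_nonneg (Real.sqrt_nonneg _) (tZero_nonneg _ _)
    rw [← hτ] at hlt
    -- half of the distance to the threshold is kept as slack
    obtain ⟨e, he⟩ : ∃ e, e = ((√41 - 1) / (√41 + 9) - τ) / 2 := ⟨_, rfl⟩
    have he0 : 0 < e := by rw [he]; linarith
    have hb : τ + e < (√41 - 1) / (√41 + 9) := by rw [he]; linarith
    have hthr : (√41 - 1) / (√41 + 9) < 1 := by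
      rw [div_lt_one (by linarith)]; linarith
    obtain ⟨g, hg⟩ : ∃ g, g = (1 + (τ + e)) / (1 - (τ + e)) := ⟨_, rfl⟩
    refine ⟨e ^ 2 / 8, max (6 / (1 - 5 * ((g - g⁻¹) / 2) / 4))
      (4 / ((1 - (τ + e)) * (1 - 5 * ((g - g⁻¹) / 2) / 4))), by positivity, fun p hp => ?_⟩
    filter_upwards [eventually_measureReal_le (by positivity : 0 < 2 * ρ) (by linarith) hδ0 hδ1
      he0 p hp] with n hn Ω _ P _ G hG
    obtain ⟨hM, hm⟩ := hn Ω P G hG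
    rw [← hτ] at hM hm
    have hm := hm (by linarith)
    refine (measureReal_mono (s₂ := {ω | (1 + (τ + e)) ^ 2 - 1 <
        cMax ⌊2 * ρ * (n : ℝ)⌋₊ (scaled (G ω))} ∪ {ω | 1 - (1 - (τ + e)) ^ 2 <
        cMin ⌊2 * ρ * (n : ℝ)⌋₊ (scaled (G ω))}) ?_ (measure_ne_top _ _)).trans
      ((measureReal_union_le _ _).trans (by linarith))
    intro ω hω
    by_contra hgood
    simp only [Set.mem_union, Set.mem_ofPred_eq, not_or, not_lt] at hgood
    refine hω fun s hs => ?_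
    have h2s : 2 * s ≤ ⌊2 * ρ * (n : ℝ)⌋₊ := by
      refine Nat.le_floor ?_
      have : (s : ℝ) ≤ ρ * n := (Nat.le_floor_iff (by positivity)).1 hs
      push_cast
      linarith
    obtain ⟨r1, r2⟩ := recovery_of_le (scaled (G ω)) (by positivity) hb
      ((cMin_mono _ h2s).trans hgood.2) ((cMax_mono _ h2s).trans hgood.1) hg
    refine ⟨r1, fun hs1 => ?_⟩
    obtain ⟨q1, q2, q3⟩ := r2 hs1
    exact ⟨q1.trans (le_max_left _ _), q2.trans (le_max_right _ _), q3⟩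
  · intro r δ ε hr0 hr1 hδ0 hδ1 hε
    obtain ⟨τ, hτ⟩ : ∃ τ, τ = √r + tZero r δ := ⟨_, rfl⟩
    have hτ0 : 0 ≤ τ := hτ ▸ add_nonneg (Real.sqrt_nonneg _) (tZero_nonneg _ _)
    obtain ⟨e, he⟩ : ∃ e, e = min 1 (ε / (4 + 2 * τ)) := ⟨_, rfl⟩
    have he0 : 0 < e := by rw [he]; positivity
    have he1 : e ≤ 1 := by rw [he]; exact min_le_left _ _
    have heε : e * (4 + 2 * τ) ≤ ε := by
      rw [← le_div_iff₀ (by positivity), he]; exact min_le_right _ _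
    refine ⟨e ^ 2 / 8, by positivity, fun p hp => ?_⟩
    filter_upwards [eventually_measureReal_le hr0 hr1 hδ0 hδ1 he0 p hp] with n hn Ω _ P _ G hG
    obtain ⟨hM, hm⟩ := hn Ω P G hG
    have e1 : 2 + √r + tZero r δ = 2 + τ := by rw [hτ]; ring
    have e2 : 2 - √r - tZero r δ = 2 - τ := by rw [hτ]; ring
    rw [e1, e2, ← hτ]
    rw [← hτ] at hM hm
    refine ⟨(measureReal_mono (fun ω hω => ?_) (measure_ne_top _ _)).trans hM, fun hτ1 => ?_⟩
    · rw [Set.mem_ofPred_eq] at hω ⊢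
      refine lt_of_lt_of_le ?_ hω
      nlinarith
    · rcases le_or_gt (τ + e) 1 with hc | hc
      · refine (measureReal_mono (fun ω hω => ?_) (measure_ne_top _ _)).trans (hm hc)
        rw [Set.mem_ofPred_eq] at hω ⊢
        refine lt_of_lt_of_le ?_ hω
        nlinarith
      · -- the level exceeds `1`, the largest possible value of `cMin`
        have hempty : {ω | τ * (2 - τ) + ε ≤ cMin ⌊r * (n : ℝ)⌋₊ (scaled (G ω))} = ∅ := by
          refine Set.eq_empty_iff_forall_notMem.2 fun ω hω => ?_
          rw [Set.mem_ofPred_eq] at hω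
          have h1 := hω.trans (cMin_le_one _ _)
          nlinarith
        rw [hempty]
        simp only [measureReal_empty]
        positivity
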